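/- Let $\mathbb{T}^n=\mathbb{R}^n/\mathbb{Z}^n$ with the flat metric induced by the Euclidean norm $\|\cdot\|$, and write $T^*\mathbb{T}^n=\mathbb{T}^n\times\mathbb{R}^n\ni(q,p)$. Let $\mathcal{U}\subset\mathcal{V}\subset T^*\mathbb{T}^n$ be open and let $H:\mathcal{V}\to\mathbb{R}$ be a $C^2$ Hamiltonian, with Hamiltonian flow $(\varphi^H_t)$ given by $\dot q=\partial_pH$, $\dot p=-\partial_qH$. Assume that $H$ is G-Lipschitz completely integrable on $\mathcal{U}$, that is: there are an open set $U\subset\mathbb{R}^n$ and maps $\eta_a:\mathbb{T}^n\to\mathbb{R}^n$ ($a\in U$) such that $(q,a)\mapsto(q,\eta_a(q))$ is a bijection from $\mathbb{T}^n\times U$ onto $\mathcal{U}$ that is locally Lipschitz together with its inverse, and such that every graph $\mathcal{T}_a=\{(q,\eta_a(q)):q\in\mathbb{T}^n\}$ is invariant under $(\varphi^H_t)$ and is a Lipschitz Lagrangian graph (that is, $\eta_a$ is Lipschitz and its derivative is symmetric at Lebesgue almost every point). Let $K>0$ be a Lipschitz constant of the foliation, i.e. $$\frac1K\|a-a'\|\le\|\eta_a(q)-\eta_{a'}(q)\|\le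 K\|a-a'\|\qquad\text{for all } q\in\mathbb{T}^n,\ a,a'\in U.$$ For $a\in U$ let $(f^a_t)$ be the flow on $\mathbb{T}^n$ defined by $\varphi^H_t(q,\eta_a(q))=(f^a_t(q),\eta_a(f^a_t(q)))$, and let $(F^a_t)$ be its lift to $\mathbb{R}^n$ that is continuous in $(t,x)$ and satisfies $F^a_0=\mathrm{id}$. Write $R_\alpha(q)=q+\alpha$ mod $\mathbb{Z}^n$. Then: 1. There is a continuous map $\rho:U\to\mathbb{R}^n$ such that $\frac{F^a_t(x)-x}{t}\to\rho(a)$ as $t\to+\infty$, uniformly in $(a,x)\in U\times\mathbb{R}^n$. 2. For every $a\in U$ for which $R_{\rho(a)}$ is minimal (all its orbits are dense), there is a homeomorphism $h_a:\mathbb{T}^n\to\mathbb{T}^n$ with $h_a\circ f^a_t=R_{t\rho(a)}\circ h_a$ for all $t\in\mathbb{R}$, such that $h_a$ and $h_a^{-1}$ are Lipschitz with constant $K^{\max(n,2)}$ (that is, $K^n$ if $n\ge2$, and $K^2$ if $n=1$). -/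

import Mathlib

open Set Filter Topology MeasureTheory

noncomputable section

/-- Euclidean space `ℝⁿ`. -/
abbrev Euc (n : ℕ) : Type := EuclideanSpace ℝ (Fin n)

/-- The integer lattice `ℤⁿ` in `ℝⁿ`. -/
def intLattice (n : ℕ) : AddSubgroup (Euc n) where
  carrier := {x | ∀ i, ∃ m : ℤ, x i = (m : ℝ)}
  zero_mem' := fun _ => ⟨0, by simp⟩
  add_mem' := by
    intro x y hx hy i
    obtain ⟨k, hk⟩ := hx i
    obtain ⟨m, hm⟩ := hy i
    exact ⟨k + m, by simp [hk, hm]⟩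
  neg_mem' := by
    intro x hx i
    obtain ⟨k, hk⟩ := hx i
    exact ⟨-k, by simp [hk]⟩

/-- The torus `𝕋ⁿ = ℝⁿ / ℤⁿ`, with the quotient group structure and the flat quotient metric:
the distance of two classes is the least Euclidean distance of representatives. -/
abbrev Torus (n : ℕ) : Type := Euc n ⧸ intLattice n

/-- The projection `ℝⁿ → 𝕋ⁿ`. -/
def toTorus {n : ℕ} (x : Euc n) : Torus n := QuotientAddGroup.mk x

/-- The cotangent bundle `T*𝕋ⁿ = 𝕋ⁿ × ℝⁿ`, with points `(q, p)`. -/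
abbrev CotTorus (n : ℕ) : Type := Torus n × Euc n

/-- The lift to `ℝⁿ × ℝⁿ` of a function on `T*𝕋ⁿ`. -/
def liftHam {n : ℕ} (H : CotTorus n → ℝ) (z : Euc n × Euc n) : ℝ := H (toTorus z.1, z.2)

/-- `H` is of class `C²` on the set `V ⊆ T*𝕋ⁿ` (used for open `V`). -/
def IsC2On {n : ℕ} (H : CotTorus n → ℝ) (V : Set (CotTorus n)) : Prop :=
  ContDiffOn ℝ 2 (liftHam H) {z : Euc n × Euc n | (toTorus z.1, z.2) ∈ V}

/-- The Hamiltonian vector field `(∂H/∂p, -∂H/∂q)`, in the coordinates of the cover. -/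
def hamVF {n : ℕ} (H : CotTorus n → ℝ) (z : Euc n × Euc n) : Euc n × Euc n :=
  (gradient (fun p => liftHam H (z.1, p)) z.2, -gradient (fun x => liftHam H (x, z.2)) z.1)

/-- `γ : ℝ → T*𝕋ⁿ` is a complete integral curve, contained in `V`, of the Hamiltonian
vector field of `H`. -/
def IsHamCurve {n : ℕ} (H : CotTorus n → ℝ) (V : Set (CotTorus n)) (γ : ℝ → CotTorus n) : Prop :=
  (∀ t, γ t ∈ V) ∧
    ∃ c : ℝ → Euc n × Euc n, (∀ t, γ t = (toTorus (c t).1, (c t).2)) ∧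
      ∀ t, HasDerivAt c (hamVF H (c t)) t

open Classical in
/-- The Hamiltonian flow `φ_t^H` on `V`. Where the orbit of `z` is complete it is unique (for `H` of
class `C²` on the open set `V`), and `hamFlow H V t z` is its point at time `t`; at the other points
the value is a dummy. -/
def hamFlow {n : ℕ} (H : CotTorus n → ℝ) (V : Set (CotTorus n)) (t : ℝ) (z : CotTorus n) :
    CotTorus n :=
  if h : ∃ γ, IsHamCurve H V γ ∧ γ 0 = z then h.choose t else z

/-- The set `S` is invariant under the Hamiltonian flow: the orbits of its points
are complete and stay in `S`. -/
def IsHamInvariant {n : ℕ} (H : CotTorus n → ℝ) (V S : Set (CotTorus n)) : Prop :=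
  ∀ z ∈ S, ∃ γ, IsHamCurve H V γ ∧ γ 0 = z ∧ ∀ t, γ t ∈ S

/-- The graph `{(q, η q) : q ∈ 𝕋ⁿ}`. -/
def torusGraph {n : ℕ} (η : Torus n → Euc n) : Set (CotTorus n) :=
  range fun q => (q, η q)

/-- The graph of `η` is a Lipschitz Lagrangian graph: `η` is Lipschitz (so differentiable almost
everywhere) and almost everywhere the tangent space of the graph is Lagrangian,
that is, the derivative of `η` is symmetric. -/
def IsLipschitzLagrangian {n : ℕ} (η : Torus n → Euc n) : Prop :=
  (∃ C, LipschitzWith C η) ∧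
    ∀ᵐ x : Euc n, ∀ u v : Euc n,
      inner ℝ (fderiv ℝ (fun y => η (toTorus y)) x u) v =
        inner ℝ u (fderiv ℝ (fun y => η (toTorus y)) x v)

/-- The `C²` Hamiltonian `H` on the open set `V ⊆ T*𝕋ⁿ` is G-Lipschitz completely integrable on the
open set `𝒰 ⊆ V`, the invariant foliation of `𝒰` being given by the graphs of the maps `η a`, with
`a` in the open set `U ⊆ ℝⁿ`: the leaves are invariant Lipschitz Lagrangian graphs, and
`(q, a) ↦ (q, η a q)` is a bijection from `𝕋ⁿ × U` to `𝒰` which is locally Lipschitz together with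
its inverse `(q, p) ↦ (q, A (q, p))`. -/
structure IsGLipschitzIntegrable {n : ℕ} (H : CotTorus n → ℝ) (V 𝒰 : Set (CotTorus n))
    (U : Set (Euc n)) (η : Euc n → Torus n → Euc n) : Prop where
  isOpen_V : IsOpen V
  isOpen_𝒰 : IsOpen 𝒰
  isOpen_U : IsOpen U
  subset : 𝒰 ⊆ V
  isC2 : IsC2On H V
  locallyLipschitz : LocallyLipschitzOn (univ ×ˢ U) fun z : Torus n × Euc n => η z.2 z.1
  inverse : ∃ A : CotTorus n → Euc n, LocallyLipschitzOn 𝒰 A ∧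
    (∀ z ∈ 𝒰, A z ∈ U ∧ η (A z) z.1 = z.2) ∧
    ∀ a ∈ U, ∀ q, (q, η a q) ∈ 𝒰 ∧ A (q, η a q) = a
  lagrangian : ∀ a ∈ U, IsLipschitzLagrangian (η a)
  invariant : ∀ a ∈ U, IsHamInvariant H V (torusGraph (η a))

/-- The restricted and projected flow `f^a_t` on `𝕋ⁿ`, for the leaf that is the graph of `ηa`. -/
def leafFlow {n : ℕ} (H : CotTorus n → ℝ) (V : Set (CotTorus n)) (ηa : Torus n → Euc n)
    (t : ℝ) (q : Torus n) : Torus n :=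
  (hamFlow H V t (q, ηa q)).1

/-- `F` is the lift to `ℝⁿ`, starting at the identity, of the flow `f` on `𝕋ⁿ`
(unique by continuity in `t`). -/
structure IsFlowLift {n : ℕ} (f : ℝ → Torus n → Torus n) (F : ℝ → Euc n → Euc n) : Prop where
  zero : ∀ x, F 0 x = x
  continuous : Continuous fun z : ℝ × Euc n => F z.1 z.2
  proj : ∀ t x, toTorus (F t x) = f t (toTorus x)

/-- The rotation `R_α : q ↦ q + α` of `𝕋ⁿ`. -/
def torusRotation {n : ℕ} (α : Euc n) : Torus n ≃ₜ Torus n := Homeomorph.addRight (toTorus α)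

/-- A homeomorphism is minimal if all its orbits are dense. -/
def IsMinimalHomeo {X : Type*} [TopologicalSpace X] (R : X ≃ₜ X) : Prop :=
  ∀ x, Dense (range fun k : ℤ => (R ^ k) x)

end

/-!
Everything happens on the universal cover, for maps and flows of `ℝⁿ` which commute with the integer
translations, and rests on the generating function of the foliation.

**Generating function.** The leaf of the parameter `a` is a Lipschitz Lagrangian graph, so `η a` is
the gradient of a function `S a` on `ℝⁿ` (`LipschitzWith.exists_primitive`). As the leaf is invariant
and Lagrangian, `H` is a constant `e a` on it (`liftHam_leaf_eq`), and a second order expansion of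
`H` in the momentum shows that the derivative of `S b - S a` along the flow of the leaf `a` is
`e b - e a + O(‖b - a‖ ^ 2)` (`eventually_energy_le`). Hence, at a parameter `a` where `S` is
differentiable, the derivative `∂ₐS` in the parameter moves along the flow with constant velocity
(`exists_paramGradient_flow`). By Rademacher and Fubini such parameters are dense
(`exists_isRegular`). For almost every `x`, the derivative of `∂ₐS` in `x` is the transpose of the
derivative of `η` in `a`, so the bi-Lipschitz bounds of the foliation say that it expands and
contracts vectors by a factor at most `K` (`ae_norm_le_fderiv_paramGradient`). It follows that all
maps of the flow are Lipschitz with the constant `K ^ 2`, uniformly in time, and, after a linear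
change of coordinates, that `∂ₐS` is a `K ^ 2`-Lipschitz map of degree one that semiconjugates the
flow to a translation flow (`exists_isLipschitzSemiconj`).

**All parameters.** These bounds do not depend on the parameter, and the flow of a leaf depends
continuously on the leaf, so the semiconjugacies pass to the limit: every leaf has one
(`exists_isLipschitzSemiconj_leafFlow`). A semiconjugacy of degree one stays at bounded distance
from the identity, which gives the rotation vector `ρ a` with the uniform error `O(1 / t)`, and
its continuity.

**Minimal rotation vectors.** Let `h` be the semiconjugacy of a leaf whose rotation is minimal. The
maps of the flow composed with integer translations are equi-Lipschitz together with their inverses.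
By minimality their limits act transitively on `ℝⁿ` (`orbitClosure_eq_univ`), and they are
symmetries of `h` up to translations of the target. So `h` looks the same, up to the factor `M`, at
every point. As `h` has degree one, the mean of its displacements in a given direction is that
direction, and this bounds the derivative of `h` from below at every point where it exists
(`norm_le_fderiv`). A proper local homeomorphism of `ℝⁿ` is a homeomorphism (`injective`), and the
pointwise bound on its derivative integrates to the Lipschitz bound of its inverse
(`norm_sub_le`). It then descends to the torus.

All the constants are `K ^ 2`. Unless the torus is a point, `1 ≤ K`, and `K ^ 2 ≤ K ^ max n 2`.
-/

open scoped NNReal ENNReal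

/-! ### Locally Lipschitz functions and their almost everywhere derivatives -/

section AEDerivative

variable {E : Type*} [NormedAddCommGroup E] [InnerProductSpace ℝ E] [FiniteDimensional ℝ E]
  [MeasurableSpace E] [BorelSpace E] {μ : Measure E} [μ.IsAddHaarMeasure]
  {F : Type*} [NormedAddCommGroup F] [InnerProductSpace ℝ F]

theorem ae_ae_add_smul {P : E → Prop} (hP : ∀ᵐ x ∂μ, P x) (v : E) :
    ∀ᵐ x ∂μ, ∀ᵐ t : ℝ, P (x + t • v) := by
  obtain ⟨s, hs, hsm, hs0⟩ := exists_measurable_superset_of_null hP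
  have h := (ae_ae_add_linearMap_mem_iff (LinearMap.toSpanSingleton ℝ E v) volume μ hsm.compl).2
    (measure_eq_zero_iff_ae_notMem.1 hs0)
  filter_upwards [h] with x hx
  filter_upwards [hx] with t ht
  by_contra hn
  exact ht (hs hn)

theorem ae_ae_smul {P : E → Prop} (hP : ∀ᵐ x ∂μ, P x) :
    ∀ᵐ x ∂μ, ∀ᵐ t : ℝ, P (t • x) := by
  obtain ⟨s, hs, hsm, hs0⟩ := exists_measurable_superset_of_null hP
  have h : ∀ᵐ t : ℝ, ∀ᵐ x ∂μ, t • x ∈ sᶜ := by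
    filter_upwards [measure_eq_zero_iff_ae_notMem.1 (Real.volume_singleton (a := 0))] with t ht
    have ht' : t ≠ 0 := by simpa using ht
    have h0 : μ ((fun x => t • x) ⁻¹' s) = 0 := by
      rw [Measure.addHaar_preimage_smul μ ht', hs0, mul_zero]
    exact measure_eq_zero_iff_ae_notMem.1 h0
  have h' := (Measure.ae_ae_comm (μ := (volume : Measure ℝ)) (ν := μ)
    (p := fun t x => t • x ∈ sᶜ) (hsm.compl.preimage (by fun_prop))).1 h
  filter_upwards [h'] with x hx
  filter_upwards [hx] with t ht
  by_contra hn
  exact ht (hs hn)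

omit [FiniteDimensional ℝ E] [MeasurableSpace E] [BorelSpace E] in
/-- The fundamental theorem of calculus along a segment, when the derivative is only known at
almost every point of the segment. -/
theorem LocallyLipschitz.sub_eq_integral {f : E → ℝ} (hf : LocallyLipschitz f)
    {G : E → E →L[ℝ] ℝ} {x v : E} (h : ∀ᵐ t : ℝ, HasFDerivAt f (G (x + t • v)) (x + t • v)) :
    f (x + v) - f x = ∫ t in (0 : ℝ)..1, G (x + t • v) v := by
  have hline : LocallyLipschitz fun t : ℝ => x + t • v := by
    have : ContDiff ℝ 1 fun t : ℝ => x + t • v := by fun_prop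
    exact this.locallyLipschitz
  obtain ⟨C, hC⟩ := ((hf.comp hline).locallyLipschitzOn
    (s := uIcc (0 : ℝ) 1)).exists_lipschitzOnWith_of_compact isCompact_uIcc
  have h1 := hC.absolutelyContinuousOnInterval.integral_deriv_eq_sub
  simp only [Function.comp_apply, one_smul, zero_smul, add_zero] at h1
  rw [← h1]
  refine intervalIntegral.integral_congr_ae ?_
  filter_upwards [h] with t ht _
  have hd : HasDerivAt (fun t : ℝ => x + t • v) v t := by
    simpa using ((hasDerivAt_id t).smul_const v).const_add x
  exact (ht.comp_hasDerivAt t hd).deriv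

theorem LocallyLipschitz.ae_sub_eq_integral {f : E → ℝ} (hf : LocallyLipschitz f)
    {G : E → E →L[ℝ] ℝ} (h : ∀ᵐ x ∂μ, HasFDerivAt f (G x) x) (v : E) :
    ∀ᵐ x ∂μ, f (x + v) - f x = ∫ t in (0 : ℝ)..1, G (x + t • v) v := by
  filter_upwards [ae_ae_add_smul h v] with x hx
  exact hf.sub_eq_integral hx

/-- A locally Lipschitz map whose derivative has norm at most `C` almost everywhere is
`C`-Lipschitz. -/
theorem LocallyLipschitz.lipschitzWith_of_ae_fderiv_le {f : E → F} (hf : LocallyLipschitz f)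
    {C : ℝ≥0} (h : ∀ᵐ x ∂μ, ∃ f' : E →L[ℝ] F, HasFDerivAt f f' x ∧ ‖f'‖ ≤ C) :
    LipschitzWith C f := by
  have key : ∀ v x, ‖f (x + v) - f x‖ ≤ C * ‖v‖ := by
    intro v
    have hc : IsClosed {x | ‖f (x + v) - f x‖ ≤ C * ‖v‖} := by
      have := hf.continuous
      exact isClosed_le (by fun_prop) (by fun_prop)
    -- testing against a fixed vector reduces the estimate to scalar functions
    have hw : ∀ w : F, ∀ x, inner ℝ w (f (x + v) - f x) ≤ ‖w‖ * (C * ‖v‖) := by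
      intro w
      have hfw : LocallyLipschitz fun x => inner ℝ w (f x) :=
        (innerSL ℝ w).lipschitz.locallyLipschitz.comp hf
      have hcw : IsClosed {x | inner ℝ w (f (x + v) - f x) ≤ ‖w‖ * (C * ‖v‖)} := by
        have := hf.continuous
        exact isClosed_le (by fun_prop) (by fun_prop)
      have hG : ∀ᵐ x ∂μ, HasFDerivAt (fun x => inner ℝ w (f x))
          ((innerSL ℝ w).comp (fderiv ℝ f x)) x ∧ ‖fderiv ℝ f x‖ ≤ C := by
        filter_upwards [h] with x ⟨f', h1, h2⟩
        rw [h1.fderiv]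
        exact ⟨(innerSL ℝ w).hasFDerivAt.comp x h1, h2⟩
      have hae : ∀ᵐ x ∂μ, x ∈ {x | inner ℝ w (f (x + v) - f x) ≤ ‖w‖ * (C * ‖v‖)} := by
        filter_upwards [ae_ae_add_smul hG v] with x hx
        have hint := hfw.sub_eq_integral
          (G := fun x => (innerSL ℝ w).comp (fderiv ℝ f x)) (hx.mono fun t ht => ht.1)
        have hb : ‖∫ t in (0 : ℝ)..1, ((innerSL ℝ w).comp (fderiv ℝ f (x + t • v))) v‖
            ≤ ‖w‖ * (C * ‖v‖) * |1 - 0| := by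
          refine intervalIntegral.norm_integral_le_of_norm_le_const_ae ?_
          filter_upwards [hx] with t ht _
          simp only [ContinuousLinearMap.comp_apply, innerSL_apply_apply]
          refine (norm_inner_le_norm _ _).trans ?_
          gcongr
          exact (ContinuousLinearMap.le_opNorm _ _).trans (by gcongr; exact ht.2)
        rw [← hint] at hb
        simp only [sub_zero, abs_one, mul_one] at hb
        have hb' := (le_abs_self _).trans hb
        rwa [← inner_sub_right] at hb'
      intro x
      exact hcw.closure_subset ((Measure.dense_of_ae hae) x)
    intro x
    have h1 := hw (f (x + v) - f x) x
    rw [real_inner_self_eq_norm_sq, sq] at h1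
    rcases (norm_nonneg (f (x + v) - f x)).eq_or_lt with h0 | h0
    · rw [← h0]; positivity
    · exact le_of_mul_le_mul_left h1 h0
  refine LipschitzWith.of_dist_le_mul fun x y => ?_
  have := key (x - y) y
  simpa [dist_eq_norm] using this

/-- A locally Lipschitz function whose almost everywhere derivative is continuous is
continuously differentiable. -/
theorem LocallyLipschitz.hasFDerivAt_of_ae {f : E → ℝ} (hf : LocallyLipschitz f)
    {G : E → E →L[ℝ] ℝ} (hG : Continuous G) (h : ∀ᵐ x ∂μ, HasFDerivAt f (G x) x) (x : E) :
    HasFDerivAt f (G x) x := by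
  have hfc := hf.continuous
  have key : ∀ v x, f (x + v) - f x = ∫ t in (0 : ℝ)..1, G (x + t • v) v := by
    intro v x
    have hc : IsClosed {x | f (x + v) - f x = ∫ t in (0 : ℝ)..1, G (x + t • v) v} := by
      refine isClosed_eq (by fun_prop) ?_
      apply intervalIntegral.continuous_parametric_intervalIntegral_of_continuous'
      fun_prop
    exact hc.closure_subset (Measure.dense_of_ae (hf.ae_sub_eq_integral h v) x)
  rw [hasFDerivAt_iff_isLittleO_nhds_zero, Asymptotics.isLittleO_iff]
  intro ε hε
  obtain ⟨δ, hδ, hd⟩ := Metric.continuousAt_iff.1 hG.continuousAt ε hε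
  filter_upwards [Metric.ball_mem_nhds (0 : E) hδ] with v hv
  have hi : ∫ t in (0 : ℝ)..1, (G (x + t • v) v - G x v) = f (x + v) - f x - G x v := by
    rw [intervalIntegral.integral_sub, ← key]
    · simp
    · exact (by fun_prop : Continuous fun t : ℝ => G (x + t • v) v).intervalIntegrable _ _
    · simp
  rw [← hi]
  have := intervalIntegral.norm_integral_le_of_norm_le_const (a := (0 : ℝ)) (b := 1)
    (f := fun t => G (x + t • v) v - G x v) (C := ε * ‖v‖) ?_
  · simpa using this
  intro t ht
  rw [uIoc_of_le zero_le_one] at ht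
  rw [← sub_apply]
  refine (ContinuousLinearMap.le_opNorm _ _).trans ?_
  gcongr
  have : dist (x + t • v) x < δ := by
    rw [dist_eq_norm, add_sub_cancel_left, norm_smul, Real.norm_eq_abs, abs_of_pos ht.1]
    have : ‖v‖ < δ := by simpa using hv
    nlinarith [norm_nonneg v, ht.2]
  exact (dist_eq_norm (G _) (G x) ▸ hd this).le

/-- The Poincaré lemma for Lipschitz vector fields: if the derivative is symmetric almost
everywhere, the field is a gradient. -/
theorem LipschitzWith.exists_primitive {η : E → E} {C : ℝ≥0} (hη : LipschitzWith C η)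
    (hsym : ∀ᵐ x ∂μ, ∀ u v : E, inner ℝ (fderiv ℝ η x u) v = inner ℝ u (fderiv ℝ η x v)) :
    ∃ S : E → ℝ, S 0 = 0 ∧ ∀ x, HasFDerivAt S (innerSL ℝ (η x)) x := by
  have hηc := hη.continuous
  have hLip : ∀ x₀ : E, ∀ s : ℝ, s ∈ Ioc (0 : ℝ) 1 → LipschitzOnWith
      (Real.nnabs (C * (‖x₀‖ + 1) + (‖η 0‖ + C * (‖x₀‖ + 1))))
      (fun x => inner ℝ (η (s • x)) x) (Metric.ball x₀ 1) := by
    intro x₀ s hs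
    refine LipschitzOnWith.of_dist_le_mul fun x hx y hy => ?_
    have hx' : ‖x‖ ≤ ‖x₀‖ + 1 := by
      have := norm_sub_norm_le x x₀
      have := mem_ball_iff_norm.1 hx
      linarith
    have hy' : ‖y‖ ≤ ‖x₀‖ + 1 := by
      have := norm_sub_norm_le y x₀
      have := mem_ball_iff_norm.1 hy
      linarith
    have h1 : ‖η (s • x) - η (s • y)‖ ≤ C * ‖x - y‖ := by
      refine (hη.norm_sub_le _ _).trans ?_
      rw [← smul_sub, norm_smul, Real.norm_eq_abs, abs_of_pos hs.1]
      gcongr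
      nlinarith [norm_nonneg (x - y), hs.2]
    have h2 : ‖η (s • y)‖ ≤ ‖η 0‖ + C * (‖x₀‖ + 1) := by
      have h3 := hη.norm_sub_le (s • y) 0
      have h4 := norm_sub_norm_le (η (s • y)) (η 0)
      have h5 : ‖s • y - 0‖ ≤ ‖x₀‖ + 1 := by
        rw [sub_zero, norm_smul, Real.norm_eq_abs, abs_of_pos hs.1]
        nlinarith [norm_nonneg y, hs.2]
      have : (C : ℝ) * ‖s • y - 0‖ ≤ C * (‖x₀‖ + 1) := by gcongr
      linarith
    have h6 : inner ℝ (η (s • x)) x - inner ℝ (η (s • y)) y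
        = inner ℝ (η (s • x) - η (s • y)) x + inner ℝ (η (s • y)) (x - y) := by
      rw [inner_sub_left, inner_sub_right]; ring
    have h7 : 0 ≤ C * (‖x₀‖ + 1) + (‖η 0‖ + C * (‖x₀‖ + 1)) := by positivity
    rw [Real.dist_eq, h6, dist_eq_norm, Real.coe_nnabs, abs_of_nonneg h7, add_mul]
    refine (abs_add_le _ _).trans (add_le_add ?_ ?_)
    · refine (abs_real_inner_le_norm _ _).trans ?_
      calc _ ≤ (C * ‖x - y‖) * (‖x₀‖ + 1) := by gcongr
        _ = _ := by ring
    · refine (abs_real_inner_le_norm _ _).trans ?_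
      gcongr
  let S : E → ℝ := fun x => ∫ s in (0 : ℝ)..1, inner ℝ (η (s • x)) x
  have hS : ∀ x, S x = ∫ s in Ioc (0 : ℝ) 1, inner ℝ (η (s • x)) x := fun x =>
    intervalIntegral.integral_of_le zero_le_one
  have hint : ∀ x, IntegrableOn (fun s : ℝ => inner ℝ (η (s • x)) x) (Ioc (0 : ℝ) 1) := fun x =>
    ((by fun_prop : Continuous fun s : ℝ => inner ℝ (η (s • x)) x).integrableOn_Icc).mono_set
      Ioc_subset_Icc_self
  have hSL : LocallyLipschitz S := by
    intro x₀
    refine ⟨_, Metric.ball x₀ 1, Metric.ball_mem_nhds _ one_pos,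
      LipschitzOnWith.of_dist_le_mul (K := Real.nnabs (C * (‖x₀‖ + 1) + (‖η 0‖ + C * (‖x₀‖ + 1))))
      fun x hx y hy => ?_⟩
    rw [hS, hS, dist_eq_norm, ← integral_sub (hint x) (hint y)]
    refine (norm_setIntegral_le_of_norm_le_const (C := Real.nnabs (C * (‖x₀‖ + 1) +
      (‖η 0‖ + C * (‖x₀‖ + 1))) * dist x y) (by simp) fun s hs => ?_).trans ?_
    · exact (dist_eq_norm _ _).symm.trans_le ((hLip x₀ s hs).dist_le_mul x hx y hy)
    · simp
  have hG : Continuous fun x => innerSL ℝ (η x) := (innerSL ℝ).continuous.comp hηc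
  refine ⟨S, by simp [S], hSL.hasFDerivAt_of_ae (μ := μ) hG ?_⟩
  filter_upwards [ae_ae_smul (hη.ae_differentiableAt.and hsym)] with x hx
  let F' : ℝ → E →L[ℝ] ℝ := fun s =>
    innerSL ℝ (η (s • x)) + s • innerSL ℝ (fderiv ℝ η (s • x) x)
  have hder := hasFDerivAt_integral_of_dominated_loc_of_lip (μ := volume.restrict (Ioc (0 : ℝ) 1))
    (F := fun (x : E) (s : ℝ) => inner ℝ (η (s • x)) x) (x₀ := x) (F' := F')
    (bound := fun _ => C * (‖x‖ + 1) + (‖η 0‖ + C * (‖x‖ + 1))) (𝕜 := ℝ)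
    (Metric.ball_mem_nhds x one_pos)
    (Eventually.of_forall fun y => (hint y).aestronglyMeasurable) (hint x) ?_
    ((ae_restrict_iff' measurableSet_Ioc).2 (Eventually.of_forall fun s hs => hLip x s hs))
    (integrable_const _) ?_
  · have heq : (∫ s in Ioc (0 : ℝ) 1, F' s) = innerSL ℝ (η x) := by
      ext v
      rw [ContinuousLinearMap.integral_apply hder.1]
      rw [← intervalIntegral.integral_of_le zero_le_one]
      have hLL : LocallyLipschitz fun s : ℝ => s * inner ℝ (η (s • x)) v := by
        have h1 : LocallyLipschitz fun s : ℝ => (s, inner ℝ (η (s • x)) v) := by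
          refine LocallyLipschitz.id.prodMk ?_
          have h2 : LocallyLipschitz fun s : ℝ => s • x :=
            (by fun_prop : ContDiff ℝ 1 fun s : ℝ => s • x).locallyLipschitz
          have h3 : LocallyLipschitz fun y : E => inner ℝ y v :=
            (contDiff_id.inner ℝ contDiff_const : ContDiff ℝ 1 fun y : E => inner ℝ y v).locallyLipschitz
          exact h3.comp (hη.locallyLipschitz.comp h2)
        have h4 : LocallyLipschitz fun p : ℝ × ℝ => p.1 * p.2 :=
          (by fun_prop : ContDiff ℝ 1 fun p : ℝ × ℝ => p.1 * p.2).locallyLipschitz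
        exact h4.comp h1
      obtain ⟨D, hD⟩ := (hLL.locallyLipschitzOn
        (s := uIcc (0 : ℝ) 1)).exists_lipschitzOnWith_of_compact isCompact_uIcc
      have h1 := hD.absolutelyContinuousOnInterval.integral_deriv_eq_sub
      simp only [one_smul, one_mul, zero_mul, sub_zero] at h1
      rw [innerSL_apply_apply, ← h1]
      refine intervalIntegral.integral_congr_ae ?_
      filter_upwards [hx] with s hs _
      have hl : HasDerivAt (fun s : ℝ => s • x) x s := by
        simpa using (hasDerivAt_id s).smul_const x
      have h2 := hs.1.hasFDerivAt.comp_hasDerivAt s hl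
      have h3 := (hasDerivAt_id s).mul (h2.inner ℝ (hasDerivAt_const s v))
      refine Eq.trans ?_ h3.deriv.symm
      simp [F']
    rw [← heq]
    exact hder.2.congr_of_eventuallyEq (Eventually.of_forall hS)
  · have hm : Measurable fun s : ℝ => fderiv ℝ η (s • x) x :=
      (measurable_fderiv_apply_const ℝ η x).comp (by fun_prop)
    have hm2 : Measurable fun s : ℝ => innerSL ℝ (fderiv ℝ η (s • x) x) :=
      (innerSL ℝ).continuous.measurable.comp hm
    have hm3 : Continuous fun s : ℝ => innerSL ℝ (η (s • x)) :=
      (innerSL ℝ).continuous.comp (by fun_prop)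
    exact (hm3.measurable.add (measurable_id.smul hm2)).aestronglyMeasurable
  · refine ae_restrict_of_ae ?_
    filter_upwards [hx] with s hs
    have hl : HasFDerivAt (fun y : E => s • y) (s • ContinuousLinearMap.id ℝ E) x :=
      (hasFDerivAt_id x).const_smul s
    have h2 := hs.1.hasFDerivAt.comp x hl
    have h3 := h2.inner ℝ (hasFDerivAt_id x)
    refine h3.congr_fderiv ?_
    ext v
    simp only [F', fderivInnerCLM_apply, ContinuousLinearMap.comp_apply,
      ContinuousLinearMap.prod_apply, add_apply, smul_apply,
      innerSL_apply_apply, ContinuousLinearMap.id_apply, Function.comp_apply, map_smul, id_eq,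
      inner_smul_left, hs.2, smul_eq_mul]
    rw [← hs.2 v x, real_inner_comm x]
    simp

end AEDerivative

/-! ### Lipschitz flows that are semiconjugate to a minimal translation -/

theorem IsCompact.exists_tendsto_ultrafilter {ι X : Type*} [TopologicalSpace X] {s : Set X}
    (hs : IsCompact s) (𝒲 : Ultrafilter ι) {f : ι → X} (hf : ∀ᶠ i in 𝒲, f i ∈ s) :
    ∃ x ∈ s, Tendsto f 𝒲 (𝓝 x) :=
  hs.ultrafilter_le_nhds' (𝒲.map f) hf

variable {n : ℕ}

theorem exists_intLattice_near (x : Euc n) : ∃ m ∈ intLattice n, ‖x - m‖ ≤ √n := by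
  refine ⟨WithLp.toLp 2 fun i => (⌊x i⌋ : ℝ), fun i => ⟨⌊x i⌋, rfl⟩, ?_⟩
  rw [EuclideanSpace.norm_eq]
  refine Real.sqrt_le_sqrt ?_
  calc _ ≤ ∑ _i : Fin n, (1 : ℝ) := Finset.sum_le_sum fun i _ => ?_
    _ = n := by simp
  have h1 := Int.fract_nonneg (x i)
  have h2 := (Int.fract_lt_one (x i)).le
  have h3 : (x - WithLp.toLp 2 fun i => (⌊x i⌋ : ℝ)) i = Int.fract (x i) := by
    exact Int.self_sub_floor (x i)
  rw [h3, Real.norm_eq_abs, abs_of_nonneg h1]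
  nlinarith

/-- A flow `F` on `ℝⁿ`, commuting with the integer translations, all of whose maps are
`M`-Lipschitz, together with an `M`-Lipschitz map `h` of degree one which semiconjugates it to the
translation flow `x ↦ x + tω`. -/
structure IsLipschitzSemiconj (F : ℝ → Euc n → Euc n) (h : Euc n → Euc n) (ω : Euc n)
    (M : ℝ≥0) : Prop where
  zero : ∀ x, F 0 x = x
  add : ∀ s t x, F (s + t) x = F s (F t x)
  equivariant : ∀ t x, ∀ m ∈ intLattice n, F t (x + m) = F t x + m
  lipschitz : ∀ t, LipschitzWith M (F t)
  lipschitz_semiconj : LipschitzWith M h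
  semiconj_add : ∀ x, ∀ m ∈ intLattice n, h (x + m) = h x + m
  semiconj : ∀ t x, h (F t x) = h x + t • ω

/-- A Lipschitz map of degree one stays at bounded distance from the identity. -/
theorem norm_sub_sub_le_of_periodic {h : Euc n → Euc n} {M : ℝ≥0} (hL : LipschitzWith M h)
    (hp : ∀ x, ∀ m ∈ intLattice n, h (x + m) = h x + m) (x : Euc n) :
    ‖h x - x - h 0‖ ≤ (M + 1) * √n := by
  obtain ⟨m, hm, hx⟩ := exists_intLattice_near x
  have h1 : h x = h (x - m) + m := by rw [← hp _ m hm, sub_add_cancel]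
  have h2 : h x - x - h 0 = (h (x - m) - h 0) - (x - m) := by rw [h1]; abel
  rw [h2]
  have h3 := hL.norm_sub_le (x - m) 0
  rw [sub_zero] at h3
  calc _ ≤ ‖h (x - m) - h 0‖ + ‖x - m‖ := norm_sub_le _ _
    _ ≤ M * ‖x - m‖ + ‖x - m‖ := by gcongr
    _ = (M + 1) * ‖x - m‖ := by ring
    _ ≤ _ := by gcongr

namespace IsLipschitzSemiconj

variable {F : ℝ → Euc n → Euc n} {h : Euc n → Euc n} {ω : Euc n} {M : ℝ≥0}

theorem le_norm_sub (H : IsLipschitzSemiconj F h ω M) (t : ℝ) (x y : Euc n) :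
    ‖x - y‖ ≤ M * ‖F t x - F t y‖ := by
  have := (H.lipschitz (-t)).norm_sub_le (F t x) (F t y)
  rwa [← H.add, ← H.add, neg_add_cancel, H.zero, H.zero] at this

theorem norm_sub_smul_le (H : IsLipschitzSemiconj F h ω M) (t : ℝ) (x : Euc n) :
    ‖F t x - x - t • ω‖ ≤ 2 * ((M + 1) * √n) := by
  have h1 := norm_sub_sub_le_of_periodic H.lipschitz_semiconj H.semiconj_add (F t x)
  have h2 := norm_sub_sub_le_of_periodic H.lipschitz_semiconj H.semiconj_add x
  have h3 : F t x - x - t • ω = (h x - x - h 0) - (h (F t x) - F t x - h 0) := by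
    rw [H.semiconj]; abel
  rw [h3, two_mul]
  exact (norm_sub_le _ _).trans (add_le_add h2 h1)

theorem isProperMap (H : IsLipschitzSemiconj F h ω M) : IsProperMap h := by
  rw [isProperMap_iff_tendsto_cocompact]
  refine ⟨H.lipschitz_semiconj.continuous, ?_⟩
  rw [← Metric.cobounded_eq_cocompact, ← tendsto_norm_atTop_iff_cobounded]
  refine tendsto_atTop_mono (f := fun x => ‖x‖ - (‖h 0‖ + (M + 1) * √n)) (fun x => ?_)
    (tendsto_atTop_add_const_right _ _ tendsto_norm_cobounded_atTop)
  have h1 := norm_sub_sub_le_of_periodic H.lipschitz_semiconj H.semiconj_add x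
  have h2 : x = h x - (h x - x - h 0) - h 0 := by abel
  have h3 := (norm_sub_le (h x - (h x - x - h 0)) (h 0)).trans
    (add_le_add_left (norm_sub_le (h x) (h x - x - h 0)) _)
  rw [← h2] at h3
  linarith

/-- The closure of the orbit of `x` in the torus, lifted to `ℝⁿ`. -/
def orbitClosure (F : ℝ → Euc n → Euc n) (x : Euc n) : Set (Euc n) :=
  closure {y | ∃ t : ℝ, ∃ m ∈ intLattice n, y = F t x + m}

theorem mem_orbitClosure {x y : Euc n} :
    y ∈ orbitClosure F x ↔ ∀ ε > 0, ∃ t : ℝ, ∃ m ∈ intLattice n, ‖y - (F t x + m)‖ < ε := by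
  simp only [orbitClosure, Metric.mem_closure_iff, dist_eq_norm]
  constructor
  · intro h ε hε
    obtain ⟨_, ⟨t, m, hm, rfl⟩, hb⟩ := h ε hε
    exact ⟨t, m, hm, hb⟩
  · intro h ε hε
    obtain ⟨t, m, hm, hb⟩ := h ε hε
    exact ⟨_, ⟨t, m, hm, rfl⟩, hb⟩

theorem self_mem_orbitClosure (H : IsLipschitzSemiconj F h ω M) (x : Euc n) :
    x ∈ orbitClosure F x :=
  subset_closure ⟨0, 0, zero_mem _, by rw [H.zero, add_zero]⟩

theorem orbitClosure_symm (H : IsLipschitzSemiconj F h ω M) {x y : Euc n}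
    (hy : y ∈ orbitClosure F x) : x ∈ orbitClosure F y := by
  rw [mem_orbitClosure] at hy ⊢
  intro ε hε
  obtain ⟨t, m, hm, hb⟩ := hy (ε / (M + 1)) (by positivity)
  refine ⟨-t, -m, neg_mem hm, ?_⟩
  have h1 : x = F (-t) (F t x + m) + -m := by
    rw [H.equivariant _ _ _ hm, ← H.add, neg_add_cancel, H.zero]; abel
  have h2 : x - (F (-t) y + -m) = F (-t) (F t x + m) - F (-t) y := by
    nth_rw 1 [h1]; abel
  rw [h2]
  have h3 := (H.lipschitz (-t)).norm_sub_le (F t x + m) y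
  rw [norm_sub_rev (F t x + m) y] at h3
  rw [lt_div_iff₀ (by positivity)] at hb
  nlinarith [norm_nonneg (y - (F t x + m))]

theorem orbitClosure_trans (H : IsLipschitzSemiconj F h ω M) {x y z : Euc n}
    (hy : y ∈ orbitClosure F x) (hz : z ∈ orbitClosure F y) : z ∈ orbitClosure F x := by
  rw [mem_orbitClosure] at hy hz ⊢
  intro ε hε
  obtain ⟨s, k, hk, hs⟩ := hz (ε / 2) (by positivity)
  obtain ⟨t, m, hm, ht⟩ := hy (ε / 2 / (M + 1)) (by positivity)
  refine ⟨s + t, m + k, add_mem hm hk, ?_⟩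
  have h1 : z - (F (s + t) x + (m + k)) =
      (z - (F s y + k)) + (F s y - F s (F t x + m)) := by
    rw [H.equivariant _ _ _ hm, H.add]; abel
  rw [h1]
  have h3 := (H.lipschitz s).norm_sub_le y (F t x + m)
  rw [lt_div_iff₀ (by positivity)] at ht
  have h4 := norm_add_le (z - (F s y + k)) (F s y - F s (F t x + m))
  nlinarith [norm_nonneg (y - (F t x + m))]

theorem orbitClosure_eq (H : IsLipschitzSemiconj F h ω M) {x y : Euc n}
    (hy : y ∈ orbitClosure F x) : orbitClosure F y = orbitClosure F x :=
  Subset.antisymm (fun _ hz => H.orbitClosure_trans hy hz)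
    fun _ hz => H.orbitClosure_trans (H.orbitClosure_symm hy) hz

theorem image_orbitClosure (H : IsLipschitzSemiconj F h ω M)
    (hω : Dense {y | ∃ t : ℝ, ∃ m ∈ intLattice n, y = t • ω + m}) (x : Euc n) :
    h '' orbitClosure F x = univ := by
  have hc : IsClosed (h '' orbitClosure F x) := H.isProperMap.isClosedMap _ isClosed_closure
  rw [← hc.closure_eq, ← dense_iff_closure_eq]
  have hd : Dense ((fun y => h x + y) '' {y | ∃ t : ℝ, ∃ m ∈ intLattice n, y = t • ω + m}) :=
    (Homeomorph.addLeft (h x)).surjective.denseRange.dense_image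
      (Homeomorph.addLeft (h x)).continuous hω
  refine hd.mono ?_
  rintro _ ⟨_, ⟨t, m, hm, rfl⟩, rfl⟩
  refine ⟨F t x + m, subset_closure ⟨t, m, hm, rfl⟩, ?_⟩
  rw [H.semiconj_add _ _ hm, H.semiconj, add_assoc]

/-- If the translation flow is minimal, so is `F`: the orbit closures are disjoint closed sets,
and each has a definite measure in a fixed ball, since its image under the Lipschitz map `h` is
everything. So there are finitely many, and connectedness leaves only one. -/
theorem orbitClosure_eq_univ (H : IsLipschitzSemiconj F h ω M)
    (hω : Dense {y | ∃ t : ℝ, ∃ m ∈ intLattice n, y = t • ω + m}) (x : Euc n) :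
    orbitClosure F x = univ := by
  let d : ℝ := Module.finrank ℝ (Euc n)
  have hd : 0 ≤ d := Nat.cast_nonneg _
  let ν : Measure (Euc n) := μH[d]
  have hν : ν.IsAddHaarMeasure := isAddHaarMeasure_hausdorffMeasure
  obtain ⟨R, hR⟩ := (H.isProperMap.isCompact_preimage
    (isCompact_closedBall (0 : Euc n) 1)).isBounded.subset_closedBall 0
  let B : Set (Euc n) := Metric.closedBall 0 R
  let ι := {O : Set (Euc n) // ∃ x, O = orbitClosure F x}
  have hclosed : ∀ i : ι, IsClosed (i : Set (Euc n)) := by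
    rintro ⟨_, y, rfl⟩
    exact isClosed_closure
  have hdisj : Pairwise (Function.onFun Disjoint fun i : ι => (i : Set (Euc n)) ∩ B) := by
    rintro ⟨_, y, rfl⟩ ⟨_, z, rfl⟩ hne
    refine Set.disjoint_left.2 fun w hw hw' => hne (Subtype.ext ?_)
    exact (H.orbitClosure_eq hw.1).symm.trans (H.orbitClosure_eq hw'.1)
  have hlow : ∀ i : ι, ν (Metric.closedBall 0 1) / (M : ℝ≥0∞) ^ d ≤ ν ((i : Set (Euc n)) ∩ B) := by
    rintro ⟨_, y, rfl⟩
    refine ENNReal.div_le_of_le_mul' ?_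
    refine le_trans (measure_mono ?_) (H.lipschitz_semiconj.hausdorffMeasure_image_le hd _)
    intro z hz
    obtain ⟨w, hw, rfl⟩ : z ∈ h '' orbitClosure F y := by
      rw [H.image_orbitClosure hω]; trivial
    exact ⟨w, ⟨hw, hR hz⟩, rfl⟩
  have hpos : 0 < ν (Metric.closedBall 0 1) / (M : ℝ≥0∞) ^ d := by
    refine ENNReal.div_pos (Metric.measure_closedBall_pos ν _ one_pos).ne' ?_
    exact ENNReal.rpow_ne_top_of_nonneg hd ENNReal.coe_ne_top
  have hfin : {i : ι | ν (Metric.closedBall 0 1) / (M : ℝ≥0∞) ^ d ≤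
      ν ((i : Set (Euc n)) ∩ B)}.Finite := by
    refine Measure.finite_const_le_meas_of_disjoint_iUnion ν hpos
      (fun i => ((hclosed i).inter Metric.isClosed_closedBall).measurableSet) hdisj ?_
    refine ne_top_of_le_ne_top (measure_closedBall_lt_top (μ := ν) (x := 0) (r := R)).ne
      (measure_mono (iUnion_subset fun i => inter_subset_right))
  have hfin' : Finite ι := by
    rw [← Set.finite_univ_iff]
    exact hfin.subset fun i _ => hlow i
  have hcompl : (orbitClosure F x)ᶜ = ⋃ i : {i : ι // (i : Set (Euc n)) ≠ orbitClosure F x},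
      ((i : ι) : Set (Euc n)) := by
    ext y
    simp only [mem_compl_iff, mem_iUnion]
    constructor
    · intro hy
      exact ⟨⟨⟨orbitClosure F y, y, rfl⟩, fun he => hy (he ▸ H.self_mem_orbitClosure y)⟩,
        H.self_mem_orbitClosure y⟩
    · rintro ⟨⟨⟨_, z, rfl⟩, hne⟩, hy⟩ hy'
      exact hne ((H.orbitClosure_eq hy).symm.trans (H.orbitClosure_eq hy'))
  have hopen : IsOpen (orbitClosure F x) := by
    rw [← isClosed_compl_iff, hcompl]
    exact isClosed_iUnion_of_finite fun i => hclosed i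
  exact IsClopen.eq_univ ⟨isClosed_closure, hopen⟩ ⟨x, H.self_mem_orbitClosure x⟩

/-- Limits of the maps of a minimal flow act transitively: any point is sent to any other one by a
bi-Lipschitz map which `h` turns into a translation. -/
theorem exists_map (H : IsLipschitzSemiconj F h ω M)
    (hω : Dense {y | ∃ t : ℝ, ∃ m ∈ intLattice n, y = t • ω + m}) (x y : Euc n) :
    ∃ g : Euc n → Euc n, g x = y ∧ LipschitzWith M g ∧ (∀ u v, ‖u - v‖ ≤ M * ‖g u - g v‖) ∧
      ∀ u, h (g u) = h u + (h y - h x) := by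
  have hy : y ∈ orbitClosure F x := by rw [H.orbitClosure_eq_univ hω]; trivial
  rw [mem_orbitClosure] at hy
  choose t m hm hb using fun k : ℕ => hy (1 / (k + 1)) Nat.one_div_pos_of_nat
  let G : ℕ → Euc n → Euc n := fun k u => F (t k) u + m k
  have hG : ∀ k, LipschitzWith M (G k) := fun k =>
    LipschitzWith.of_dist_le_mul fun u v => by
      simpa [G] using (H.lipschitz (t k)).dist_le_mul u v
  have hGx : Tendsto (fun k => G k x) atTop (𝓝 y) := by
    rw [tendsto_iff_norm_sub_tendsto_zero]
    refine squeeze_zero (fun _ => norm_nonneg _) (fun k => ?_) tendsto_one_div_add_atTop_nhds_zero_nat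
    rw [norm_sub_rev]
    exact (hb k).le
  let 𝒲 : Ultrafilter ℕ := hyperfilter ℕ
  have h𝒲 : (𝒲 : Filter ℕ) ≤ atTop := Nat.hyperfilter_le_atTop
  have hlim : ∀ u, ∃ v, Tendsto (fun k => G k u) 𝒲 (𝓝 v) := by
    intro u
    have hmem : ∀ k, G k u ∈ Metric.closedBall y (M * ‖u - x‖ + 1) := fun k => by
      have h1 := (hG k).norm_sub_le u x
      have h2 : ‖y - G k x‖ < 1 := (hb k).trans_le (by
        rw [div_le_one (by positivity)]; linarith [(Nat.cast_nonneg k : (0 : ℝ) ≤ k)])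
      rw [norm_sub_rev] at h2
      rw [mem_closedBall_iff_norm, ← sub_add_sub_cancel _ (G k x) _]
      exact (norm_add_le _ _).trans (add_le_add h1 h2.le)
    obtain ⟨v, -, hv⟩ := (isCompact_closedBall y (M * ‖u - x‖ + 1)).exists_tendsto_ultrafilter 𝒲
      (Eventually.of_forall hmem)
    exact ⟨v, hv⟩
  choose g hg using hlim
  have hgx : g x = y := tendsto_nhds_unique (hg x) (hGx.mono_left h𝒲)
  refine ⟨g, hgx, ?_, fun u v => ?_, fun u => ?_⟩
  · refine LipschitzWith.of_dist_le_mul fun u v => ?_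
    exact le_of_tendsto' ((hg u).dist (hg v)) fun k => (hG k).dist_le_mul u v
  · refine ge_of_tendsto' (((hg u).sub (hg v)).norm.const_mul _) fun k => ?_
    simpa [G] using H.le_norm_sub (t k) u v
  · have hcont := H.lipschitz_semiconj.continuous
    have h1 := (hcont.tendsto _).comp (hg u)
    have h2 := (hcont.tendsto _).comp (hg x)
    have h3 : ∀ k, h (G k u) - h u = h (G k x) - h x := fun k => by
      simp only [G, H.semiconj_add _ _ (hm k), H.semiconj]; abel
    have h4 := tendsto_nhds_unique ((h1.sub_const (h u)).congr h3) (h2.sub_const (h x))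
    rw [hgx] at h4
    rw [← h4]; abel

/-! ### Semiconjugacies to minimal translations are bi-Lipschitz homeomorphisms -/

/-- The mean displacement of `h` along a long chain in a direction `w` is `w`, and each step of the
chain can be moved to the given point `x`. So `w` is an average of displacements of `h` close
to `x`, hence the image of a vector of controlled size under the derivative at `x`. -/
theorem exists_fderiv_apply_eq (H : IsLipschitzSemiconj F h ω M)
    (hω : Dense {y | ∃ t : ℝ, ∃ m ∈ intLattice n, y = t • ω + m}) {x : Euc n}
    {L : Euc n →L[ℝ] Euc n} (hL : HasFDerivAt h L x) (w : Euc n) :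
    ∃ u, ‖u‖ ≤ M * ‖w‖ ∧ L u = w := by
  rcases eq_or_ne w 0 with rfl | hw0
  · exact ⟨0, by simp⟩
  have hw : 0 < ‖w‖ := norm_pos_iff.2 hw0
  suffices hcl : w ∈ closure (L '' Metric.closedBall 0 (M * ‖w‖)) by
    have hc : IsClosed (L '' Metric.closedBall 0 (M * ‖w‖)) :=
      ((isCompact_closedBall _ _).image L.continuous).isClosed
    obtain ⟨u, hu, rfl⟩ := hc.closure_eq ▸ hcl
    exact ⟨u, by simpa using hu, rfl⟩
  rw [Metric.mem_closure_iff]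
  intro ε hε
  let ε' : ℝ := ε / (4 * (M * ‖w‖ + 1))
  have hε' : 0 < ε' := by positivity
  rw [hasFDerivAt_iff_isLittleO_nhds_zero, Asymptotics.isLittleO_iff] at hL
  obtain ⟨r, hr, hb⟩ := Metric.eventually_nhds_iff_ball.1 (hL hε')
  let δ : ℝ := r / (2 * (M * ‖w‖ + 1))
  have hδ : 0 < δ := by positivity
  have hδr : M * (δ * ‖w‖) < r := by
    have : δ * (2 * (M * ‖w‖ + 1)) = r := div_mul_cancel₀ _ (by positivity)
    nlinarith [mul_nonneg M.2 hw.le]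
  let C : ℝ := (M + 1) * √n
  obtain ⟨N, hN⟩ := exists_nat_gt (4 * C / (δ * ε))
  have hC : 0 ≤ C := by positivity
  have hN0 : (0 : ℝ) < N := lt_of_le_of_lt (by positivity) hN
  rw [div_lt_iff₀ (by positivity)] at hN
  let p : ℕ → Euc n := fun j => (j * δ) • w
  choose g hgp hg1 _ hg3 using fun j => H.exists_map hω (p j) x
  let u : ℕ → Euc n := fun j => g j (p (j + 1)) - x
  have hp : ∀ j, p (j + 1) - p j = δ • w := fun j => by
    simp only [p, ← sub_smul]; congr 1; push_cast; ring
  have hu : ∀ j, ‖u j‖ ≤ M * (δ * ‖w‖) := by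
    intro j
    have := (hg1 j).norm_sub_le (p (j + 1)) (p j)
    rwa [hp, hgp, norm_smul, Real.norm_of_nonneg hδ.le] at this
  have hv : ∀ j, ‖h (p (j + 1)) - h (p j) - L (u j)‖ ≤ ε' * (M * (δ * ‖w‖)) := by
    intro j
    have h1 := hb (u j) (by rw [mem_ball_zero_iff]; exact (hu j).trans_lt hδr)
    have h2 : h (x + u j) - h x = h (p (j + 1)) - h (p j) := by
      simp only [u, add_sub_cancel, hg3]; abel
    rw [h2] at h1
    exact h1.trans (by gcongr; exact hu j)
  have hsum : ‖h (p N) - h (p 0) - L (∑ j ∈ Finset.range N, u j)‖ ≤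
      N * (ε' * (M * (δ * ‖w‖))) := by
    rw [map_sum, ← Finset.sum_range_sub (fun j => h (p j)), ← Finset.sum_sub_distrib]
    refine (norm_sum_le_of_le _ fun j _ => hv j).trans ?_
    simp
  have hdrift : ‖(N * δ) • w - (h (p N) - h (p 0))‖ ≤ C := by
    have h1 := norm_sub_sub_le_of_periodic H.lipschitz_semiconj H.semiconj_add (p N)
    have h2 : (N * δ) • w - (h (p N) - h (p 0)) = -(h (p N) - p N - h 0) := by
      simp only [p, Nat.cast_zero, zero_mul, zero_smul]; abel
    rw [h2, norm_neg]
    exact h1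
  have hNδ : (0 : ℝ) < N * δ := by positivity
  refine ⟨L ((N * δ)⁻¹ • ∑ j ∈ Finset.range N, u j), mem_image_of_mem _ ?_, ?_⟩
  · rw [mem_closedBall_zero_iff, norm_smul, norm_inv, Real.norm_of_nonneg hNδ.le,
      inv_mul_le_iff₀ hNδ]
    refine (norm_sum_le_of_le _ fun j _ => hu j).trans ?_
    simp only [Finset.sum_const, Finset.card_range, nsmul_eq_mul]
    exact le_of_eq (by ring)
  · have h1 : w - L ((N * δ)⁻¹ • ∑ j ∈ Finset.range N, u j) =
        (N * δ)⁻¹ • (((N * δ) • w - (h (p N) - h (p 0))) +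
          (h (p N) - h (p 0) - L (∑ j ∈ Finset.range N, u j))) := by
      rw [sub_add_sub_cancel, smul_sub, smul_smul, inv_mul_cancel₀ hNδ.ne', one_smul, map_smul]
    rw [dist_eq_norm, h1, norm_smul, norm_inv, Real.norm_of_nonneg hNδ.le, inv_mul_lt_iff₀ hNδ]
    refine (norm_add_le _ _).trans_lt ((add_le_add hdrift hsum).trans_lt ?_)
    have h2 : ε' * (4 * (M * ‖w‖ + 1)) = ε := div_mul_cancel₀ _ (by positivity)
    have h3 : ε' * (M * ‖w‖) ≤ ε / 4 := by nlinarith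
    have h4 : N * (ε' * (M * (δ * ‖w‖))) ≤ N * δ * (ε / 4) := by
      calc _ = N * δ * (ε' * (M * ‖w‖)) := by ring
        _ ≤ _ := by gcongr
    nlinarith [mul_pos hNδ hε]

theorem norm_le_fderiv (H : IsLipschitzSemiconj F h ω M)
    (hω : Dense {y | ∃ t : ℝ, ∃ m ∈ intLattice n, y = t • ω + m}) {x : Euc n}
    {L : Euc n →L[ℝ] Euc n} (hL : HasFDerivAt h L x) (v : Euc n) : ‖v‖ ≤ M * ‖L v‖ := by
  have hsurj : Function.Surjective L := fun w =>
    (H.exists_fderiv_apply_eq hω hL w).imp fun _ hu => hu.2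
  have hinj : Function.Injective L := LinearMap.injective_iff_surjective.2 hsurj
  obtain ⟨u, hu, he⟩ := H.exists_fderiv_apply_eq hω hL (L v)
  rwa [hinj he] at hu

/-- The estimate at one point of differentiability is carried to all points by the transitive
action. -/
theorem exists_norm_sub_le (H : IsLipschitzSemiconj F h ω M)
    (hω : Dense {y | ∃ t : ℝ, ∃ m ∈ intLattice n, y = t • ω + m}) (hM : 1 ≤ M) :
    ∃ r > 0, ∀ x y, ‖x - y‖ < r → ‖x - y‖ ≤ 2 * M ^ 2 * ‖h x - h y‖ := by
  have hM0 : (0 : ℝ) < M := by exact_mod_cast one_pos.trans_le hM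
  obtain ⟨x₀, hx₀⟩ := (H.lipschitz_semiconj.ae_differentiableAt (μ := volume)).exists
  have hL := hx₀.hasFDerivAt
  have hanti := H.norm_le_fderiv hω hL
  rw [hasFDerivAt_iff_isLittleO_nhds_zero, Asymptotics.isLittleO_iff] at hL
  obtain ⟨r, hr, hb⟩ := Metric.eventually_nhds_iff_ball.1 (hL (c := (2 * (M : ℝ))⁻¹) (by positivity))
  have hloc : ∀ u, ‖u‖ < r → ‖u‖ ≤ 2 * M * ‖h (x₀ + u) - h x₀‖ := by
    intro u hu
    have h1 := hb u (by rwa [mem_ball_zero_iff])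
    have h2 := norm_sub_norm_le (fderiv ℝ h x₀ u) (h (x₀ + u) - h x₀)
    rw [norm_sub_rev (fderiv ℝ h x₀ u)] at h2
    have h3 : (M : ℝ) * ((2 * (M : ℝ))⁻¹ * ‖u‖) = ‖u‖ / 2 := by field_simp
    have h4 := hanti u
    nlinarith
  refine ⟨r / M, by positivity, fun x y hxy => ?_⟩
  obtain ⟨g, hg, hg1, hg2, hg3⟩ := H.exists_map hω y x₀
  have h1 := hg1.norm_sub_le x y
  rw [lt_div_iff₀ hM0] at hxy
  have h2 := hloc (g x - x₀) (by rw [← hg]; linarith)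
  have h3 : h (x₀ + (g x - x₀)) - h x₀ = h x - h y := by
    rw [add_sub_cancel, hg3]; abel
  rw [h3, ← hg] at h2
  calc ‖x - y‖ ≤ M * ‖g x - g y‖ := hg2 x y
    _ ≤ M * (2 * M * ‖h x - h y‖) := by gcongr
    _ = _ := by ring

theorem surjective (H : IsLipschitzSemiconj F h ω M)
    (hω : Dense {y | ∃ t : ℝ, ∃ m ∈ intLattice n, y = t • ω + m}) : Function.Surjective h :=
  fun z => by
    obtain ⟨w, -, hw⟩ : z ∈ h '' orbitClosure F 0 := by
      rw [H.image_orbitClosure hω]; trivial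
    exact ⟨w, hw⟩

/-- `h` is open for the same reason as a surjective homomorphism of compact groups: it is a closed
map, and the maps of `exists_map` act transitively on its fibres. -/
theorem isOpenMap (H : IsLipschitzSemiconj F h ω M)
    (hω : Dense {y | ∃ t : ℝ, ∃ m ∈ intLattice n, y = t • ω + m}) : IsOpenMap h := by
  intro U hU
  rw [isOpen_iff_mem_nhds]
  rintro _ ⟨x, hx, rfl⟩
  -- the points that a map commuting with `h` brings into `U`
  let W : Set (Euc n) := ⋃ g ∈ {g : Euc n → Euc n | Continuous g ∧ ∀ u, h (g u) = h u}, g ⁻¹' U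
  have hW : IsOpen W := isOpen_biUnion fun g hg => hU.preimage hg.1
  have hclosed : IsClosed (h '' Wᶜ) := H.isProperMap.isClosedMap _ hW.isClosed_compl
  have hnot : h x ∉ h '' Wᶜ := by
    rintro ⟨y, hy, hyx⟩
    obtain ⟨g, hg, hg1, -, hg3⟩ := H.exists_map hω y x
    refine hy (mem_biUnion (x := g) ⟨hg1.continuous, fun u => ?_⟩ (by rwa [mem_preimage, hg]))
    rw [hg3, hyx, sub_self, add_zero]
  filter_upwards [hclosed.isOpen_compl.mem_nhds hnot] with z hz
  obtain ⟨y, rfl⟩ := H.surjective hω z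
  have hy : y ∈ W := by
    by_contra hy
    exact hz ⟨y, hy, rfl⟩
  obtain ⟨g, hg, hgy⟩ := mem_iUnion₂.1 hy
  exact ⟨g y, hgy, hg.2 y⟩

/-- `h` is a covering map of the simply connected space `ℝⁿ`, hence injective. -/
theorem injective (H : IsLipschitzSemiconj F h ω M)
    (hω : Dense {y | ∃ t : ℝ, ∃ m ∈ intLattice n, y = t • ω + m}) (hM : 1 ≤ M) :
    Function.Injective h := by
  obtain ⟨r, hr, hloc⟩ := H.exists_norm_sub_le hω hM
  have hcont := H.lipschitz_semiconj.continuous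
  have hinj : ∀ x, InjOn h (Metric.ball x (r / 2)) := by
    intro x y hy z hz hyz
    have h1 : ‖y - z‖ < r := by
      rw [← dist_eq_norm]
      have := dist_triangle_right y z x
      rw [Metric.mem_ball] at hy hz
      linarith
    have h2 := hloc y z h1
    rw [hyz, sub_self, norm_zero, mul_zero] at h2
    exact sub_eq_zero.1 (norm_le_zero_iff.1 h2)
  have hlh : IsLocalHomeomorph h := by
    rw [isLocalHomeomorph_iff_isOpenEmbedding_restrict]
    intro x
    refine ⟨Metric.ball x (r / 2), Metric.ball_mem_nhds x (by positivity), ?_⟩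
    refine .of_continuous_injective_isOpenMap ?_ (injOn_iff_injective.1 (hinj x)) ?_
    · exact hcont.comp continuous_subtype_val
    · exact (H.isOpenMap hω).comp Metric.isOpen_ball.isOpenMap_subtype_val
  have hcov : IsCoveringMap h := by
    rw [isCoveringMap_iff_isCoveringMapOn_univ]
    refine H.isProperMap.isClosedMap.isCoveringMapOn_of_isLocalHomeomorphOn (fun z _ => ?_)
      fun x _ => hlh x
    refine (H.isProperMap.isCompact_preimage isCompact_singleton).finite
      (.of_openPartialHomeomorph h subset_rfl fun e _ => ?_)
    obtain ⟨φ, hφ, he⟩ := hlh e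
    exact ⟨φ, hφ, he.symm⟩
  obtain ⟨P, ⟨hP0, hP⟩, -⟩ := hcov.existsUnique_continuousMap_lifts (ContinuousMap.id (Euc n))
    (h 0) 0 rfl
  have hid : P ∘ h = id := by
    refine hcov.eq_of_comp_eq (P.continuous.comp hcont) continuous_id ?_ 0 hP0
    rw [← Function.comp_assoc, hP]
    rfl
  exact Function.LeftInverse.injective (congrFun hid)

/-- The inverse of `h` is `M`-Lipschitz, because its derivative is bounded by `M` wherever `h` is
differentiable. -/
theorem norm_sub_le (H : IsLipschitzSemiconj F h ω M)
    (hω : Dense {y | ∃ t : ℝ, ∃ m ∈ intLattice n, y = t • ω + m}) (hM : 1 ≤ M) (x y : Euc n) :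
    ‖x - y‖ ≤ M * ‖h x - h y‖ := by
  have hcont := H.lipschitz_semiconj.continuous
  let e : Euc n ≃ₜ Euc n := (Equiv.ofBijective h
    ⟨H.injective hω hM, H.surjective hω⟩).toHomeomorphOfContinuousOpen hcont (H.isOpenMap hω)
  have he : ∀ x, e x = h x := fun _ => rfl
  obtain ⟨r, hr, hloc⟩ := H.exists_norm_sub_le hω hM
  have hP : LocallyLipschitz e.symm := by
    intro z
    have hnhds : e.symm ⁻¹' Metric.ball (e.symm z) (r / 2) ∈ 𝓝 z :=
      e.symm.continuous.continuousAt (Metric.ball_mem_nhds _ (by positivity))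
    refine ⟨2 * M ^ 2, _, hnhds, LipschitzOnWith.of_dist_le_mul fun u hu v hv => ?_⟩
    have h1 : ‖e.symm u - e.symm v‖ < r := by
      rw [← dist_eq_norm]
      have := dist_triangle_right (e.symm u) (e.symm v) (e.symm z)
      rw [mem_preimage, Metric.mem_ball] at hu hv
      linarith
    have h2 := hloc _ _ h1
    rw [← he, ← he, e.apply_symm_apply, e.apply_symm_apply] at h2
    simpa [dist_eq_norm] using h2
  let ν : Measure (Euc n) := μH[(Module.finrank ℝ (Euc n) : ℝ)]
  have hν : ν.IsAddHaarMeasure := isAddHaarMeasure_hausdorffMeasure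
  have hnull : ∀ᵐ z ∂ν, DifferentiableAt ℝ h (e.symm z) := by
    have h0 : ν {x | ¬ DifferentiableAt ℝ h x} = 0 :=
      H.lipschitz_semiconj.ae_differentiableAt (μ := ν)
    have h1 : ν (h '' {x | ¬ DifferentiableAt ℝ h x}) = 0 := by
      refine le_antisymm ?_ zero_le
      refine (H.lipschitz_semiconj.hausdorffMeasure_image_le (Nat.cast_nonneg _) _).trans ?_
      exact (mul_eq_zero.2 (Or.inr h0)).le
    filter_upwards [measure_eq_zero_iff_ae_notMem.1 h1] with z hz
    by_contra hd
    exact hz ⟨e.symm z, hd, e.apply_symm_apply z⟩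
  have hLip : LipschitzWith M e.symm := by
    refine hP.lipschitzWith_of_ae_fderiv_le (μ := ν) ?_
    filter_upwards [hnull] with z hz
    have hanti := H.norm_le_fderiv hω hz.hasFDerivAt
    have hinj : Function.Injective (fderiv ℝ h (e.symm z)) := by
      refine (injective_iff_map_eq_zero _).2 fun v hv => ?_
      have := hanti v
      rw [hv, norm_zero, mul_zero] at this
      exact norm_le_zero_iff.1 this
    let A : Euc n ≃L[ℝ] Euc n :=
      (LinearEquiv.ofInjectiveEndo (fderiv ℝ h (e.symm z)).toLinearMap hinj).toContinuousLinearEquiv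
    have hA : (A : Euc n →L[ℝ] Euc n) = fderiv ℝ h (e.symm z) := by
      ext v; rfl
    refine ⟨A.symm, HasFDerivAt.of_local_left_inverse e.symm.continuous.continuousAt
      (f := h) (by rw [hA]; exact hz.hasFDerivAt)
      (Eventually.of_forall fun y => e.apply_symm_apply y), ?_⟩
    refine ContinuousLinearMap.opNorm_le_bound _ M.2 fun v => ?_
    have h1 := hanti (A.symm v)
    rw [← hA] at h1
    simpa using h1
  have := hLip.norm_sub_le (e x) (e y)
  rwa [e.symm_apply_apply, e.symm_apply_apply] at this

end IsLipschitzSemiconj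

/-! ### Pointwise derivatives: limits and lower bounds -/

section Pointwise

variable {E F : Type*} [NormedAddCommGroup E] [NormedSpace ℝ E] [NormedAddCommGroup F]
  [NormedSpace ℝ F]

/-- A function which can be approximated, up to an error that is `ε`-Lipschitz at `a`, by functions
differentiable at `a`, is differentiable at `a`. -/
theorem differentiableAt_of_approx [CompleteSpace F] {f : E → F} {a : E}
    (h : ∀ ε > 0, ∃ φ : E → F, DifferentiableAt ℝ φ a ∧
      ∀ᶠ b in 𝓝 a, ‖(f b - f a) - (φ b - φ a)‖ ≤ ε * ‖b - a‖) : DifferentiableAt ℝ f a := by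
  choose φ hφ hb using fun k : ℕ => h (1 / (k + 1)) Nat.one_div_pos_of_nat
  let L : ℕ → E →L[ℝ] F := fun k => fderiv ℝ (φ k) a
  have hLL : ∀ k j : ℕ, ‖L k - L j‖ ≤ 1 / (k + 1) + 1 / (j + 1) := by
    intro k j
    refine HasFDerivAt.le_of_lip' ((hφ k).hasFDerivAt.sub (hφ j).hasFDerivAt) (by positivity) ?_
    filter_upwards [hb k, hb j] with b h1 h2
    have h3 : (φ k - φ j) b - (φ k - φ j) a =
        ((f b - f a) - (φ j b - φ j a)) - ((f b - f a) - (φ k b - φ k a)) := by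
      simp only [Pi.sub_apply]; abel
    rw [h3, add_mul, add_comm]
    exact (norm_sub_le _ _).trans (add_le_add h2 h1)
  have h0 := tendsto_one_div_add_atTop_nhds_zero_nat (𝕜 := ℝ)
  have hC : CauchySeq L := by
    refine Metric.cauchySeq_iff'.2 fun ε hε => ?_
    obtain ⟨N, hN⟩ := (h0.eventually (gt_mem_nhds (half_pos hε))).exists_forall_of_atTop
    refine ⟨N, fun k hk => ?_⟩
    rw [dist_eq_norm]
    linarith [hLL k N, hN k hk, hN N le_rfl]
  obtain ⟨L₀, hL₀⟩ := cauchySeq_tendsto_of_complete hC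
  have hLk : ∀ k : ℕ, ‖L k - L₀‖ ≤ 1 / (k + 1) := by
    intro k
    have h1 : Tendsto (fun j => ‖L k - L j‖) atTop (𝓝 ‖L k - L₀‖) :=
      (tendsto_const_nhds.sub hL₀).norm
    have h2 := (tendsto_const_nhds (x := (1 / (k + 1) : ℝ))).add h0
    rw [add_zero] at h2
    exact le_of_tendsto_of_tendsto' h1 h2 fun j => hLL k j
  refine ⟨L₀, ?_⟩
  rw [hasFDerivAt_iff_isLittleO, Asymptotics.isLittleO_iff]
  intro ε hε
  obtain ⟨k, hk⟩ := (h0.eventually (gt_mem_nhds (by positivity : (0 : ℝ) < ε / 3))).exists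
  have hd := (hφ k).hasFDerivAt
  rw [hasFDerivAt_iff_isLittleO, Asymptotics.isLittleO_iff] at hd
  filter_upwards [hb k, hd (by positivity : (0 : ℝ) < ε / 3)] with b h1 h2
  have h3 : f b - f a - L₀ (b - a) = ((f b - f a) - (φ k b - φ k a)) +
      (φ k b - φ k a - L k (b - a)) + (L k - L₀) (b - a) := by
    rw [sub_apply]; abel
  have h4 : ‖(L k - L₀) (b - a)‖ ≤ ε / 3 * ‖b - a‖ :=
    (ContinuousLinearMap.le_opNorm _ _).trans (by gcongr; exact (hLk k).trans hk.le)
  have h5 : 1 / ((k : ℝ) + 1) * ‖b - a‖ ≤ ε / 3 * ‖b - a‖ := by gcongr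
  rw [h3]
  refine (norm_add₃_le).trans ?_
  linarith

theorem HasFDerivAt.norm_le_of_norm_sub_le {f : E → F} {a : E} {L : E →L[ℝ] F}
    (hf : HasFDerivAt f L a) {K : ℝ} (h : ∀ᶠ b in 𝓝 a, ‖b - a‖ ≤ K * ‖f b - f a‖) (w : E) :
    ‖w‖ ≤ K * ‖L w‖ := by
  have h1 := (hf.hasLineDerivAt w).tendsto_slope_zero_right.norm.const_mul K
  refine ge_of_tendsto h1 ?_
  have h2 : Tendsto (fun t : ℝ => a + t • w) (𝓝[>] 0) (𝓝 a) := by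
    have : Tendsto (fun t : ℝ => a + t • w) (𝓝 0) (𝓝 (a + (0 : ℝ) • w)) :=
      (by fun_prop : Continuous fun t : ℝ => a + t • w).tendsto 0
    rw [zero_smul, add_zero] at this
    exact this.mono_left nhdsWithin_le_nhds
  filter_upwards [h2.eventually h, self_mem_nhdsWithin] with t ht ht0
  have ht0' : 0 < t := ht0
  rw [add_sub_cancel_left, norm_smul, Real.norm_of_nonneg ht0'.le] at ht
  rw [norm_smul, norm_inv, Real.norm_of_nonneg ht0'.le, ← mul_assoc, mul_comm K, mul_assoc,
    ← div_eq_inv_mul, le_div_iff₀ ht0', mul_comm]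
  exact ht

end Pointwise

/-- A lower bound for a linear map is inherited by its transpose. -/
theorem norm_le_of_transpose {E : Type*} [NormedAddCommGroup E] [InnerProductSpace ℝ E]
    [FiniteDimensional ℝ E] {A B : E →L[ℝ] E} {K : ℝ} (hB : ∀ w, ‖w‖ ≤ K * ‖B w‖)
    (hAB : ∀ v w, inner ℝ (A v) w = inner ℝ v (B w)) (v : E) : ‖v‖ ≤ K * ‖A v‖ := by
  have hinj : Function.Injective B := by
    refine (injective_iff_map_eq_zero B).2 fun w hw => ?_
    have := hB w
    rw [hw, norm_zero, mul_zero] at this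
    exact norm_le_zero_iff.1 this
  obtain ⟨w, rfl⟩ := (LinearMap.injective_iff_surjective (f := B.toLinearMap)).1 hinj v
  change ‖B w‖ ≤ K * ‖A (B w)‖
  rcases (norm_nonneg (B w)).eq_or_lt with h0 | h0
  · have : w = 0 := hinj (by rw [map_zero]; exact norm_eq_zero.1 h0.symm)
    simp [this]
  · have h1 : ‖B w‖ * ‖B w‖ ≤ ‖A (B w)‖ * ‖w‖ := by
      rw [← real_inner_self_eq_norm_mul_norm, ← hAB]
      exact real_inner_le_norm _ _
    have h2 : ‖A (B w)‖ * ‖w‖ ≤ ‖A (B w)‖ * (K * ‖B w‖) := by gcongr; exact hB w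
    refine le_of_mul_le_mul_right (a := ‖B w‖) ?_ h0
    linarith

/-! ### Families of gradients on the torus that depend on a parameter in a bi-Lipschitz way -/

/-- A family, parametrized by the open set `U`, of periodic Lipschitz vector fields `η a` on `ℝⁿ`
with primitives `S a`; the family is `K`-bi-Lipschitz in the parameter. -/
structure IsGradientFamily (U : Set (Euc n)) (η : Euc n → Euc n → Euc n) (S : Euc n → Euc n → ℝ)
    (K : ℝ) : Prop where
  isOpen : IsOpen U
  pos : 0 < K
  zero : ∀ a ∈ U, S a 0 = 0
  hasFDerivAt : ∀ a ∈ U, ∀ x, HasFDerivAt (S a) (innerSL ℝ (η a x)) x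
  periodic : ∀ a ∈ U, ∀ x, ∀ m ∈ intLattice n, η a (x + m) = η a x
  lipschitz : ∀ a ∈ U, ∃ C, LipschitzWith C (η a)
  le_norm_sub : ∀ a ∈ U, ∀ a' ∈ U, ∀ x, ‖a - a'‖ ≤ K * ‖η a x - η a' x‖
  norm_sub_le : ∀ a ∈ U, ∀ a' ∈ U, ∀ x, ‖η a x - η a' x‖ ≤ K * ‖a - a'‖

/-- The cohomology class of the closed one-form `η a`, as the vector of the increments of its
primitive `S a` along the standard basis. -/
noncomputable def cohomClass (S : Euc n → Euc n → ℝ) (a : Euc n) : Euc n :=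
  WithLp.toLp 2 fun i => S a (EuclideanSpace.single i 1)

namespace IsGradientFamily

variable {U : Set (Euc n)} {η : Euc n → Euc n → Euc n} {S : Euc n → Euc n → ℝ} {K : ℝ}

theorem continuous (H : IsGradientFamily U η S K) {a : Euc n} (ha : a ∈ U) : Continuous (η a) :=
  (H.lipschitz a ha).choose_spec.continuous

theorem hasFDerivAt_sub (H : IsGradientFamily U η S K) {a b : Euc n} (ha : a ∈ U) (hb : b ∈ U)
    (x : Euc n) : HasFDerivAt (fun x => S b x - S a x) (innerSL ℝ (η b x - η a x)) x := by
  rw [map_sub]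
  exact (H.hasFDerivAt b hb x).sub (H.hasFDerivAt a ha x)

theorem norm_sub_sub_le (H : IsGradientFamily U η S K) {a b : Euc n} (ha : a ∈ U) (hb : b ∈ U)
    (x y : Euc n) : ‖(S b x - S a x) - (S b y - S a y)‖ ≤ K * ‖b - a‖ * ‖x - y‖ := by
  refine convex_univ.norm_image_sub_le_of_norm_hasFDerivWithin_le (f := fun x => S b x - S a x)
    (fun z _ => (H.hasFDerivAt_sub ha hb z).hasFDerivWithinAt) (fun z _ => ?_) (mem_univ y)
    (mem_univ x)
  rw [innerSL_apply_norm]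
  exact H.norm_sub_le b hb a ha z

theorem norm_sub_le' (H : IsGradientFamily U η S K) {a b : Euc n} (ha : a ∈ U) (hb : b ∈ U)
    (x : Euc n) : ‖S b x - S a x‖ ≤ K * ‖b - a‖ * ‖x‖ := by
  simpa [H.zero a ha, H.zero b hb] using H.norm_sub_sub_le ha hb x 0

theorem add_intLattice_aux (H : IsGradientFamily U η S K) {a : Euc n} (ha : a ∈ U) (x m : Euc n)
    (hm : m ∈ intLattice n) : S a (x + m) = S a x + S a m := by
  have hd : ∀ x, HasFDerivAt (fun x => S a (x + m) - S a x) (0 : Euc n →L[ℝ] ℝ) x := by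
    intro x
    have h1 : HasFDerivAt (fun x => S a (x + m)) (innerSL ℝ (η a (x + m))) x :=
      (hasFDerivAt_comp_add_right m).2 (H.hasFDerivAt a ha (x + m))
    have h2 := h1.sub (H.hasFDerivAt a ha x)
    rwa [H.periodic a ha x m hm, sub_self] at h2
  have := is_const_of_fderiv_eq_zero (𝕜 := ℝ) (fun x => (hd x).differentiableAt)
    (fun x => (hd x).fderiv) x 0
  rw [zero_add, H.zero a ha] at this
  linarith

theorem add_intLattice (H : IsGradientFamily U η S K) {a : Euc n} (ha : a ∈ U) (x m : Euc n)
    (hm : m ∈ intLattice n) : S a (x + m) = S a x + inner ℝ (cohomClass S a) m := by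
  rw [H.add_intLattice_aux ha x m hm]
  congr 1
  let φ : intLattice n →+ ℝ :=
    { toFun := fun m => S a m
      map_zero' := H.zero a ha
      map_add' := fun k m => H.add_intLattice_aux ha k m m.2 }
  choose z hz using hm
  let e : Fin n → intLattice n := fun i => ⟨EuclideanSpace.single i 1, fun j => by
    rcases eq_or_ne j i with rfl | hj
    · exact ⟨1, by simp⟩
    · exact ⟨0, by simp [hj]⟩⟩
  have hsum : (⟨m, fun i => ⟨z i, hz i⟩⟩ : intLattice n) = ∑ i, z i • e i := by
    ext j
    simp [e, hz, Finset.sum_apply, Pi.single_apply]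
  have h1 : φ ⟨m, fun i => ⟨z i, hz i⟩⟩ = ∑ i, (z i : ℝ) * S a (EuclideanSpace.single i 1) := by
    rw [hsum, map_sum]
    refine Finset.sum_congr rfl fun i _ => ?_
    rw [map_zsmul, zsmul_eq_mul]
    rfl
  change φ ⟨m, fun i => ⟨z i, hz i⟩⟩ = _
  rw [h1, PiLp.inner_apply]
  refine Finset.sum_congr rfl fun i _ => ?_
  simp [cohomClass, hz]

/-- Two fields of the family differ by the difference of their classes at some point: at a maximum
of the periodic function whose gradient is the difference minus its class. -/
theorem exists_sub_eq (H : IsGradientFamily U η S K) {a b : Euc n} (ha : a ∈ U) (hb : b ∈ U) :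
    ∃ x, η b x - η a x = cohomClass S b - cohomClass S a := by
  let c := cohomClass S b - cohomClass S a
  let W : Euc n → ℝ := fun x => S b x - S a x - inner ℝ c x
  have hW : ∀ x, HasFDerivAt W (innerSL ℝ (η b x - η a x - c)) x := by
    intro x
    rw [map_sub]
    exact (H.hasFDerivAt_sub ha hb x).sub (innerSL ℝ c).hasFDerivAt
  have hper : ∀ x, ∀ m ∈ intLattice n, W (x + m) = W x := by
    intro x m hm
    simp only [W, H.add_intLattice ha x m hm, H.add_intLattice hb x m hm, c, inner_add_right,
      inner_sub_left]
    ring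
  have hcont : Continuous W := continuous_iff_continuousAt.2 fun x => (hW x).continuousAt
  obtain ⟨x, -, hx⟩ := (isCompact_closedBall (0 : Euc n) √n).exists_isMaxOn
    ⟨0, by simp⟩ hcont.continuousOn
  have hmax : ∀ y, W y ≤ W x := by
    intro y
    obtain ⟨m, hm, hy⟩ := exists_intLattice_near y
    rw [← sub_add_cancel y m, hper _ m hm]
    exact hx (by simpa using hy)
  refine ⟨x, ?_⟩
  have h0 : innerSL ℝ (η b x - η a x - c) = 0 :=
    IsLocalMax.hasFDerivAt_eq_zero (Eventually.of_forall hmax) (hW x)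
  have h1 : η b x - η a x - c = 0 := by
    rw [← norm_eq_zero, ← innerSL_apply_norm (𝕜 := ℝ), h0, norm_zero]
  exact sub_eq_zero.1 h1

theorem norm_sub_le_cohomClass (H : IsGradientFamily U η S K) {a b : Euc n} (ha : a ∈ U)
    (hb : b ∈ U) : ‖b - a‖ ≤ K * ‖cohomClass S b - cohomClass S a‖ := by
  obtain ⟨x, hx⟩ := H.exists_sub_eq ha hb
  rw [← hx]
  exact H.le_norm_sub b hb a ha x

/-! ### The derivative of the generating function in the parameter -/

/-- The parameters `a` at which every primitive value `S · x` is differentiable, and at which almost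
every field value `η · x` is differentiable. -/
def IsRegular (η : Euc n → Euc n → Euc n) (S : Euc n → Euc n → ℝ) (a : Euc n) : Prop :=
  (∀ x, DifferentiableAt ℝ (fun b => S b x) a) ∧ ∀ᵐ x, DifferentiableAt ℝ (fun b => η b x) a

theorem exists_isRegular (H : IsGradientFamily U η S K) {a₀ : Euc n} (ha₀ : a₀ ∈ U) {ε : ℝ}
    (hε : 0 < ε) : ∃ a ∈ U, ‖a - a₀‖ < ε ∧ IsRegular η S a := by
  obtain ⟨r, hr, hrU⟩ := Metric.nhds_basis_closedBall.mem_iff.1 (H.isOpen.mem_nhds ha₀)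
  have hballU : Metric.ball a₀ r ⊆ U := Metric.ball_subset_closedBall.trans hrU
  have hD : ∀ᵐ a, ∀ k : ℕ, a ∈ Metric.ball a₀ r →
      DifferentiableAt ℝ (fun b => S b (TopologicalSpace.denseSeq (Euc n) k)) a := by
    rw [ae_all_iff]
    intro k
    have hL : LipschitzOnWith (Real.toNNReal (K * ‖TopologicalSpace.denseSeq (Euc n) k‖))
        (fun b => S b (TopologicalSpace.denseSeq (Euc n) k)) (Metric.ball a₀ r) := by
      refine LipschitzOnWith.of_dist_le_mul fun b hb a ha => ?_
      have := H.norm_sub_le' (hballU ha) (hballU hb) (TopologicalSpace.denseSeq (Euc n) k)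
      rw [dist_eq_norm, dist_eq_norm, Real.coe_toNNReal _ (by have := H.pos; positivity)]
      linarith
    filter_upwards [hL.ae_differentiableWithinAt_of_mem (μ := volume)] with a h ha
    exact (h ha).differentiableAt (Metric.isOpen_ball.mem_nhds ha)
  have hη : ∀ᵐ a, ∀ᵐ x, a ∈ Metric.ball a₀ r → DifferentiableAt ℝ (fun b => η b x) a := by
    -- a retraction onto the closed ball makes the family continuous for all parameters
    let p : Euc n → Euc n := fun b => a₀ + (r / max r ‖b - a₀‖) • (b - a₀)
    have hmax : ∀ b, 0 < max r ‖b - a₀‖ := fun b => lt_max_of_lt_left hr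
    have hp : Continuous p := by
      have : ∀ b, max r ‖b - a₀‖ ≠ 0 := fun b => (hmax b).ne'
      fun_prop (disch := assumption)
    have hpU : ∀ b, p b ∈ U := by
      intro b
      apply hrU
      rw [mem_closedBall_iff_norm, add_sub_cancel_left, norm_smul,
        Real.norm_of_nonneg (by positivity), div_mul_eq_mul_div, div_le_iff₀ (hmax b)]
      gcongr
      exact le_max_right _ _
    have hpb : ∀ b ∈ Metric.ball a₀ r, p b = b := by
      intro b hb
      have : max r ‖b - a₀‖ = r := max_eq_left (mem_ball_iff_norm.1 hb).le
      simp [p, this, hr.ne']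
    have hc : Continuous (Function.uncurry fun x b => η (p b) x) := by
      rw [continuous_iff_continuousAt]
      rintro ⟨x, b⟩
      rw [ContinuousAt, tendsto_iff_norm_sub_tendsto_zero]
      have h1 : Tendsto (fun z : Euc n × Euc n => K * ‖p z.2 - p b‖ + ‖η (p b) z.1 - η (p b) x‖)
          (𝓝 (x, b)) (𝓝 0) := by
        have hcη := H.continuous (hpU b)
        have : Continuous fun z : Euc n × Euc n =>
            K * ‖p z.2 - p b‖ + ‖η (p b) z.1 - η (p b) x‖ := by fun_prop
        simpa using this.tendsto (x, b)
      refine squeeze_zero (fun _ => norm_nonneg _) (fun z => ?_) h1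
      refine (norm_sub_le_norm_sub_add_norm_sub _ (η (p b) z.1) _).trans ?_
      exact add_le_add (H.norm_sub_le _ (hpU _) _ (hpU b) _) le_rfl
    have hm := measurableSet_of_differentiableAt_with_param ℝ hc
    have hx : ∀ᵐ x : Euc n, ∀ᵐ a : Euc n, a ∈ Metric.ball a₀ r →
        DifferentiableAt ℝ (fun b => η (p b) x) a := by
      refine Eventually.of_forall fun x => ?_
      have hL : LipschitzOnWith (Real.toNNReal K) (fun b => η (p b) x) (Metric.ball a₀ r) := by
        refine LipschitzOnWith.of_dist_le_mul fun b hb a ha => ?_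
        rw [hpb a ha, hpb b hb, dist_eq_norm, dist_eq_norm, Real.coe_toNNReal _ H.pos.le]
        exact H.norm_sub_le b (hballU hb) a (hballU ha) x
      filter_upwards [hL.ae_differentiableWithinAt_of_mem (μ := volume)] with a h ha
      exact (h ha).differentiableAt (Metric.isOpen_ball.mem_nhds ha)
    have hm' : MeasurableSet {z : Euc n × Euc n | z.2 ∈ Metric.ball a₀ r →
        DifferentiableAt ℝ (fun b => η (p b) z.1) z.2} := by
      have h1 : MeasurableSet {z : Euc n × Euc n | z.2 ∈ Metric.ball a₀ r} :=
        measurable_snd Metric.isOpen_ball.measurableSet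
      exact h1.imp hm
    have hx' := (Measure.ae_ae_comm (μ := (volume : Measure (Euc n)))
      (ν := (volume : Measure (Euc n))) (p := fun x a => a ∈ Metric.ball a₀ r →
        DifferentiableAt ℝ (fun b => η (p b) x) a) hm').1 hx
    filter_upwards [hx'] with a ha
    filter_upwards [ha] with x hxa har
    refine (hxa har).congr_of_eventuallyEq ?_
    filter_upwards [Metric.isOpen_ball.mem_nhds har] with b hb
    rw [hpb b hb]
  have hpos : 0 < volume (Metric.ball a₀ (min r ε)) :=
    Metric.measure_ball_pos _ _ (lt_min hr hε)
  obtain ⟨a, ha, h1, h2⟩ := (frequently_ae_mem_iff.2 hpos.ne').and_eventually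
    (hD.and hη) |>.exists
  have har : a ∈ Metric.ball a₀ r := Metric.ball_subset_ball (min_le_left _ _) ha
  refine ⟨a, hballU har, ?_, fun x => ?_, ?_⟩
  · rw [← mem_ball_iff_norm]
    exact Metric.ball_subset_ball (min_le_right _ _) ha
  · refine differentiableAt_of_approx fun δ hδ => ?_
    obtain ⟨k, hk⟩ := (TopologicalSpace.denseRange_denseSeq (Euc n)).exists_dist_lt x
      (div_pos hδ H.pos)
    refine ⟨_, h1 k har, ?_⟩
    filter_upwards [H.isOpen.mem_nhds (hballU har)] with b hb
    have h3 := H.norm_sub_sub_le (hballU har) hb x (TopologicalSpace.denseSeq (Euc n) k)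
    rw [dist_eq_norm, lt_div_iff₀ H.pos] at hk
    refine h3.trans ?_
    nlinarith [norm_nonneg (b - a)]
  · filter_upwards [h2] with x hx using hx har

/-- The derivative of the generating function `S` in the parameter, as a map of `x`. -/
noncomputable def paramGradient (S : Euc n → Euc n → ℝ) (a x : Euc n) : Euc n :=
  gradient (fun b => S b x) a

theorem hasFDerivAt_paramGradient {a : Euc n} (ha : IsRegular η S a) (x : Euc n) :
    HasFDerivAt (fun b => S b x) (innerSL ℝ (paramGradient S a x)) a :=
  (ha.1 x).hasGradientAt.hasFDerivAt

theorem lipschitzWith_paramGradient (H : IsGradientFamily U η S K) {a : Euc n} (haU : a ∈ U)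
    (ha : IsRegular η S a) : LipschitzWith (Real.toNNReal K) (paramGradient S a) := by
  refine LipschitzWith.of_dist_le_mul fun x y => ?_
  rw [dist_eq_norm, dist_eq_norm, Real.coe_toNNReal _ H.pos.le, ← innerSL_apply_norm (𝕜 := ℝ),
    map_sub]
  refine HasFDerivAt.le_of_lip' ((hasFDerivAt_paramGradient ha x).sub
    (hasFDerivAt_paramGradient ha y)) (by have := H.pos; positivity) ?_
  filter_upwards [H.isOpen.mem_nhds haU] with b hb
  have := H.norm_sub_sub_le haU hb x y
  have h2 : ((fun b => S b x) - fun b => S b y) b - ((fun b => S b x) - fun b => S b y) a =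
      (S b x - S a x) - (S b y - S a y) := by
    simp only [Pi.sub_apply]; ring
  rw [h2]
  linarith

/-- The periods of the parameter derivative: it has degree one up to an invertible linear map. -/
theorem paramGradient_add (H : IsGradientFamily U η S K) {a : Euc n} (haU : a ∈ U)
    (ha : IsRegular η S a) : ∃ T : Euc n →L[ℝ] Euc n, (∀ v, ‖v‖ ≤ K * ‖T v‖) ∧
      ∀ x, ∀ m ∈ intLattice n, paramGradient S a (x + m) = paramGradient S a x + T m := by
  have hc : DifferentiableAt ℝ (cohomClass S) a := by
    have h1 : DifferentiableAt ℝ (fun b => fun i : Fin n => S b (EuclideanSpace.single i 1)) a :=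
      differentiableAt_pi.2 fun i => ha.1 _
    exact (PiLp.continuousLinearEquiv 2 ℝ fun _ : Fin n => ℝ).symm.differentiableAt.comp a h1
  let D := fderiv ℝ (cohomClass S) a
  have hD : ∀ w, ‖w‖ ≤ K * ‖D w‖ := by
    refine hc.hasFDerivAt.norm_le_of_norm_sub_le ?_
    filter_upwards [H.isOpen.mem_nhds haU] with b hb
    exact H.norm_sub_le_cohomClass haU hb
  refine ⟨ContinuousLinearMap.adjoint D, norm_le_of_transpose hD fun v w =>
    ContinuousLinearMap.adjoint_inner_left D w v, fun x m hm => ?_⟩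
  have h1 : HasFDerivAt (fun b => S b x + inner ℝ (cohomClass S b) m)
      (innerSL ℝ (paramGradient S a x) + innerSL ℝ (ContinuousLinearMap.adjoint D m)) a := by
    refine (hasFDerivAt_paramGradient ha x).add ?_
    refine (hc.hasFDerivAt.inner ℝ (hasFDerivAt_const m a)).congr_fderiv ?_
    ext w
    simp [ContinuousLinearMap.adjoint_inner_left, real_inner_comm, D]
  have h2 : HasFDerivAt (fun b => S b (x + m))
      (innerSL ℝ (paramGradient S a x) + innerSL ℝ (ContinuousLinearMap.adjoint D m)) a := by
    refine h1.congr_of_eventuallyEq ?_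
    filter_upwards [H.isOpen.mem_nhds haU] with b hb
    exact H.add_intLattice hb x m hm
  have h3 := (hasFDerivAt_paramGradient ha (x + m)).unique h2
  rw [← map_add] at h3
  rw [← sub_eq_zero, ← norm_eq_zero, ← innerSL_apply_norm (𝕜 := ℝ), map_sub, h3, sub_self,
    norm_zero]

/-- The mixed second derivatives of the generating function commute almost everywhere. Against a
test function, both are limits of the same difference quotients. -/
theorem ae_lineDeriv_paramGradient (H : IsGradientFamily U η S K) {a : Euc n} (haU : a ∈ U)
    (ha : IsRegular η S a) (v w : Euc n) :
    ∀ᵐ x, lineDeriv ℝ (fun x => inner ℝ (paramGradient S a x) w) x v =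
      inner ℝ (fderiv ℝ (fun b => η b x) a w) v := by
  have hK := H.pos
  let g : Euc n → ℝ := fun x => inner ℝ (paramGradient S a x) w
  obtain ⟨C, hgL⟩ : ∃ C, LipschitzWith C g := by
    have h1 : LipschitzWith _ fun y : Euc n => innerSL ℝ w y := (innerSL ℝ w).lipschitz
    have h2 : g = (fun y : Euc n => innerSL ℝ w y) ∘ paramGradient S a := by
      ext x
      simp only [g, Function.comp_apply, innerSL_apply_apply, real_inner_comm]
    rw [h2]
    exact ⟨_, h1.comp (H.lipschitzWith_paramGradient haU ha)⟩
  -- difference quotients in the parameter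
  let Q : ℝ → Euc n → ℝ := fun s x => s⁻¹ * (S (a + s • w) x - S a x)
  let q : ℝ → Euc n → Euc n := fun s x => s⁻¹ • (η (a + s • w) x - η a x)
  have hU : ∀ᶠ s in 𝓝[>] (0 : ℝ), a + s • w ∈ U ∧ 0 < s := by
    have h1 : Tendsto (fun s : ℝ => a + s • w) (𝓝 0) (𝓝 (a + (0 : ℝ) • w)) :=
      (by fun_prop : Continuous fun s : ℝ => a + s • w).tendsto 0
    rw [zero_smul, add_zero] at h1
    filter_upwards [nhdsWithin_le_nhds (h1.eventually (H.isOpen.mem_nhds haU)),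
      self_mem_nhdsWithin] with s hs hs0 using ⟨hs, hs0⟩
  have hq : ∀ s, a + s • w ∈ U → 0 < s → ∀ x, ‖q s x‖ ≤ K * ‖w‖ := by
    intro s hs hs0 x
    rw [norm_smul, norm_inv, Real.norm_of_nonneg hs0.le, inv_mul_le_iff₀ hs0]
    refine (H.norm_sub_le _ hs _ haU x).trans (le_of_eq ?_)
    rw [add_sub_cancel_left, norm_smul, Real.norm_of_nonneg hs0.le]
    ring
  have hQ : ∀ s, a + s • w ∈ U → 0 < s → ∀ x, ‖Q s x‖ ≤ K * ‖w‖ * ‖x‖ := by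
    intro s hs hs0 x
    rw [norm_mul, norm_inv, Real.norm_of_nonneg hs0.le, inv_mul_le_iff₀ hs0]
    refine (H.norm_sub_le' haU hs x).trans (le_of_eq ?_)
    rw [add_sub_cancel_left, norm_smul, Real.norm_of_nonneg hs0.le]
    ring
  have hQd : ∀ s, a + s • w ∈ U → ∀ x, HasFDerivAt (Q s) (innerSL ℝ (q s x)) x := by
    intro s hs x
    rw [map_smul]
    exact (H.hasFDerivAt_sub haU hs x).const_mul s⁻¹
  have hQL : ∀ s, a + s • w ∈ U → 0 < s → LipschitzWith (Real.toNNReal (K * ‖w‖)) (Q s) := by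
    intro s hs hs0
    refine lipschitzWith_of_nnnorm_fderiv_le (𝕜 := ℝ) (fun x => (hQd s hs x).differentiableAt)
      fun x => ?_
    rw [(hQd s hs x).fderiv, ← NNReal.coe_le_coe, coe_nnnorm, innerSL_apply_norm,
      Real.coe_toNNReal _ (by positivity)]
    exact hq s hs hs0 x
  have hqc : ∀ s, a + s • w ∈ U → Continuous (q s) := fun s hs =>
    ((H.continuous hs).sub (H.continuous haU)).const_smul s⁻¹
  have hQlim : ∀ x, Tendsto (fun s => Q s x) (𝓝[>] 0) (𝓝 (g x)) := by
    intro x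
    have := ((hasFDerivAt_paramGradient ha x).hasLineDerivAt w).tendsto_slope_zero_right
    simpa [Q, g] using this
  have hqlim : ∀ᵐ x, Tendsto (fun s => inner ℝ (q s x) v) (𝓝[>] 0)
      (𝓝 (inner ℝ (fderiv ℝ (fun b => η b x) a w) v)) := by
    filter_upwards [ha.2] with x hx
    exact (hx.hasFDerivAt.hasLineDerivAt w).tendsto_slope_zero_right.inner tendsto_const_nhds
  have hmeas : AEStronglyMeasurable
      (fun x => inner ℝ (fderiv ℝ (fun b => η b x) a w) v) volume := by
    obtain ⟨u, hu⟩ := exists_seq_tendsto (𝓝[>] (0 : ℝ))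
    obtain ⟨N, hN⟩ := (hu.eventually hU).exists_forall_of_atTop
    refine aestronglyMeasurable_of_tendsto_ae (atTop : Filter ℕ)
      (f := fun k x => inner ℝ (q (u (k + N)) x) v) (fun k => ?_) ?_
    · have := hqc _ (hN (k + N) (by omega)).1
      exact (by fun_prop : Continuous fun x => inner ℝ (q (u (k + N)) x) v).aestronglyMeasurable
    · filter_upwards [hqlim] with x hx
      exact (hx.comp hu).comp (tendsto_add_atTop_nat N)
  have hbound : ∀ᵐ x, ‖(inner ℝ (fderiv ℝ (fun b => η b x) a w) v : ℝ)‖ ≤ K * ‖w‖ * ‖v‖ := by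
    filter_upwards [hqlim] with x hx
    refine le_of_tendsto hx.norm ?_
    filter_upwards [hU] with s hs
    exact (norm_inner_le_norm _ _).trans (by gcongr; exact hq s hs.1 hs.2 x)
  refine ae_eq_of_integral_contDiff_smul_eq (hgL.locallyIntegrable_lineDeriv v) ?_ ?_
  · rw [locallyIntegrable_iff]
    intro k hk
    exact Measure.integrableOn_of_bounded hk.measure_lt_top.ne hmeas (ae_restrict_of_ae hbound)
  intro φ hφ hφc
  obtain ⟨D, hφL⟩ := (hφ.of_le (by exact_mod_cast le_top)
    : ContDiff ℝ 1 φ).lipschitzWith_of_hasCompactSupport hφc one_ne_zero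
  simp only [smul_eq_mul]
  have hφd : Differentiable ℝ φ := hφ.differentiable (by simp)
  have hlφ : ∀ x, lineDeriv ℝ φ x (-v) = fderiv ℝ φ x (-v) := fun x =>
    (hφd x).lineDeriv_eq_fderiv
  have hfc : Continuous fun x => fderiv ℝ φ x (-v) :=
    (hφ.continuous_fderiv (by simp)).clm_apply continuous_const
  have hfs : HasCompactSupport fun x => fderiv ℝ φ x (-v) := hφc.fderiv_apply ℝ (-v)
  have hpart : ∀ s, a + s • w ∈ U → 0 < s →
      ∫ x, φ x * inner ℝ (q s x) v = ∫ x, fderiv ℝ φ x (-v) * Q s x := by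
    intro s hs hs0
    have h1 := (hQL s hs hs0).integral_lineDeriv_mul_eq (μ := volume) hφL hφc v
    simp only [hlφ] at h1
    rw [← h1]
    refine integral_congr_ae (Eventually.of_forall fun x => ?_)
    simp only
    rw [(hQd s hs x).differentiableAt.lineDeriv_eq_fderiv, (hQd s hs x).fderiv,
      innerSL_apply_apply, mul_comm]
  have hpart' : ∫ x, φ x * lineDeriv ℝ g x v = ∫ x, fderiv ℝ φ x (-v) * g x := by
    have h1 := hgL.integral_lineDeriv_mul_eq (μ := volume) hφL hφc v
    simp only [hlφ] at h1
    rw [← h1]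
    exact integral_congr_ae (Eventually.of_forall fun x => mul_comm _ _)
  have hlim1 : Tendsto (fun s => ∫ x, φ x * inner ℝ (q s x) v) (𝓝[>] 0)
      (𝓝 (∫ x, φ x * inner ℝ (fderiv ℝ (fun b => η b x) a w) v)) := by
    refine tendsto_integral_filter_of_dominated_convergence
      (fun x => ‖φ x‖ * (K * ‖w‖ * ‖v‖)) ?_ ?_ ?_ ?_
    · filter_upwards [hU] with s hs
      have := hqc s hs.1
      have := hφ.continuous
      exact (by fun_prop : Continuous fun x => φ x * inner ℝ (q s x) v).aestronglyMeasurable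
    · filter_upwards [hU] with s hs
      refine Eventually.of_forall fun x => ?_
      rw [norm_mul]
      gcongr
      exact (norm_inner_le_norm _ _).trans (by gcongr; exact hq s hs.1 hs.2 x)
    · exact (hφ.continuous.integrable_of_hasCompactSupport hφc).norm.mul_const _
    · filter_upwards [hqlim] with x hx using hx.const_mul _
  have hlim2 : Tendsto (fun s => ∫ x, fderiv ℝ φ x (-v) * Q s x) (𝓝[>] 0)
      (𝓝 (∫ x, fderiv ℝ φ x (-v) * g x)) := by
    refine tendsto_integral_filter_of_dominated_convergence
      (fun x => ‖fderiv ℝ φ x (-v)‖ * (K * ‖w‖ * ‖x‖)) ?_ ?_ ?_ ?_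
    · filter_upwards [hU] with s hs
      have := (hQL s hs.1 hs.2).continuous
      exact (hfc.mul this).aestronglyMeasurable
    · filter_upwards [hU] with s hs
      refine Eventually.of_forall fun x => ?_
      rw [norm_mul]
      gcongr
      exact hQ s hs.1 hs.2 x
    · exact Continuous.integrable_of_hasCompactSupport (by fun_prop) hfs.norm.mul_right
    · exact Eventually.of_forall fun x => (hQlim x).const_mul _
  rw [hpart']
  refine tendsto_nhds_unique (hlim2.congr' ?_) hlim1
  filter_upwards [hU] with s hs using (hpart s hs.1 hs.2).symm

theorem ae_norm_le_fderiv_paramGradient (H : IsGradientFamily U η S K) {a : Euc n} (haU : a ∈ U)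
    (ha : IsRegular η S a) : ∀ᵐ x, DifferentiableAt ℝ (paramGradient S a) x ∧
      ∀ v, ‖v‖ ≤ K * ‖fderiv ℝ (paramGradient S a) x v‖ := by
  let e := EuclideanSpace.basisFun (Fin n) ℝ
  have h1 : ∀ᵐ x, ∀ i j, lineDeriv ℝ (fun x => inner ℝ (paramGradient S a x) (e j)) x (e i) =
      inner ℝ (fderiv ℝ (fun b => η b x) a (e j)) (e i) :=
    ae_all_iff.2 fun i => ae_all_iff.2 fun j => H.ae_lineDeriv_paramGradient haU ha (e i) (e j)
  filter_upwards [h1, ha.2, (H.lipschitzWith_paramGradient haU ha).ae_differentiableAt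
    (μ := volume)] with x hx hη hd
  refine ⟨hd, norm_le_of_transpose (B := fderiv ℝ (fun b => η b x) a) ?_ ?_⟩
  · refine hη.hasFDerivAt.norm_le_of_norm_sub_le ?_
    filter_upwards [H.isOpen.mem_nhds haU] with b hb
    exact H.le_norm_sub b hb a haU x
  · have h2 : ∀ i j, inner ℝ (fderiv ℝ (paramGradient S a) x (e i)) (e j) =
        inner ℝ (e i) (fderiv ℝ (fun b => η b x) a (e j)) := by
      intro i j
      rw [real_inner_comm _ (e i), ← hx i j]
      have h3 : HasFDerivAt (fun x => inner ℝ (paramGradient S a x) (e j)) _ x :=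
        hd.hasFDerivAt.inner ℝ (hasFDerivAt_const (e j) x)
      rw [h3.differentiableAt.lineDeriv_eq_fderiv, h3.fderiv]
      simp
    intro v w
    rw [← e.sum_repr v, ← e.sum_repr w]
    simp only [map_sum, map_smul, sum_inner, inner_sum, inner_smul_left, inner_smul_right, h2]

/-! ### Flows which preserve the leaves -/

/-- If the derivative of `S b - S a` along the flow is a constant up to second order in `b - a`,
then the derivative of `S` in the parameter moves along the flow with constant velocity. -/
theorem exists_paramGradient_flow (H : IsGradientFamily U η S K) {a : Euc n} (haU : a ∈ U)
    (ha : IsRegular η S a) {F : ℝ → Euc n → Euc n} {X : Euc n → Euc n} (hF0 : ∀ x, F 0 x = x)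
    (hF : ∀ t x, HasDerivAt (fun t => F t x) (X (F t x)) t) {e : Euc n → ℝ} {C : ℝ}
    (he : ∀ᶠ b in 𝓝 a, ∀ x, |e b - e a - inner ℝ (η b x - η a x) (X x)| ≤ C * ‖b - a‖ ^ 2) :
    ∃ ω, ∀ t x, paramGradient S a (F t x) = paramGradient S a x + t • ω := by
  have hdrift : ∀ b ∈ U, (∀ x, |e b - e a - inner ℝ (η b x - η a x) (X x)| ≤ C * ‖b - a‖ ^ 2) →
      ∀ t x, |(S b (F t x) - S a (F t x)) - (S b x - S a x) - t * (e b - e a)| ≤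
        C * ‖b - a‖ ^ 2 * |t| := by
    intro b hb hbe t x
    have hd : ∀ t, HasDerivAt (fun t => (S b (F t x) - S a (F t x)) - t * (e b - e a))
        (inner ℝ (η b (F t x) - η a (F t x)) (X (F t x)) - 1 * (e b - e a)) t := by
      intro t
      have h0 := H.hasFDerivAt_sub haU hb (F t x)
      have h1 : HasDerivAt (fun t => S b (F t x) - S a (F t x))
          (inner ℝ (η b (F t x) - η a (F t x)) (X (F t x))) t := by
        rw [← innerSL_apply_apply ℝ]
        exact h0.comp_hasDerivAt t (hF t x)
      exact h1.sub ((hasDerivAt_id t).mul_const _)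
    have h1 := convex_univ.norm_image_sub_le_of_norm_hasDerivWithin_le
      (fun t _ => (hd t).hasDerivWithinAt) (C := C * ‖b - a‖ ^ 2) (fun t _ => by
        rw [one_mul, Real.norm_eq_abs, abs_sub_comm]
        exact hbe (F t x)) (mem_univ 0) (mem_univ t)
    simp only [hF0, zero_mul, sub_zero, Real.norm_eq_abs] at h1
    convert h1 using 2
    ring
  refine ⟨paramGradient S a (F 1 0) - paramGradient S a 0, fun t x => ?_⟩
  refine ext_inner_right ℝ fun w => ?_
  let l : Filter ℝ := 𝓝[>] 0
  have hline : Tendsto (fun s : ℝ => a + s • w) l (𝓝 a) := by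
    have h1 : Tendsto (fun s : ℝ => a + s • w) (𝓝 0) (𝓝 (a + (0 : ℝ) • w)) :=
      (by fun_prop : Continuous fun s : ℝ => a + s • w).tendsto 0
    rw [zero_smul, add_zero] at h1
    exact h1.mono_left nhdsWithin_le_nhds
  have hQ : ∀ x, Tendsto (fun s => s⁻¹ * (S (a + s • w) x - S a x)) l
      (𝓝 (inner ℝ (paramGradient S a x) w)) := by
    intro x
    have := ((hasFDerivAt_paramGradient ha x).hasLineDerivAt w).tendsto_slope_zero_right
    simpa using this
  have hR : ∀ t x, Tendsto (fun s => t * (s⁻¹ * (e (a + s • w) - e a))) l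
      (𝓝 (inner ℝ (paramGradient S a (F t x)) w - inner ℝ (paramGradient S a x) w)) := by
    intro t x
    have h0 : Tendsto (fun s : ℝ => s * (C * ‖w‖ ^ 2 * |t|)) l (𝓝 0) := by
      have : Tendsto (fun s : ℝ => s * (C * ‖w‖ ^ 2 * |t|)) (𝓝 0) (𝓝 (0 * (C * ‖w‖ ^ 2 * |t|))) :=
        (by fun_prop : Continuous fun s : ℝ => s * (C * ‖w‖ ^ 2 * |t|)).tendsto 0
      rw [zero_mul] at this
      exact this.mono_left nhdsWithin_le_nhds
    refine ((hQ (F t x)).sub (hQ x)).congr_dist (squeeze_zero' (.of_forall fun _ => dist_nonneg) ?_ h0)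
    filter_upwards [self_mem_nhdsWithin, hline.eventually he,
      hline.eventually (H.isOpen.mem_nhds haU)] with s hs hes hsU
    have hs0 : 0 < s := hs
    have h1 := hdrift _ hsU hes t x
    rw [add_sub_cancel_left, norm_smul, Real.norm_of_nonneg hs0.le] at h1
    have h2 : s⁻¹ * (S (a + s • w) (F t x) - S a (F t x)) - s⁻¹ * (S (a + s • w) x - S a x) -
        t * (s⁻¹ * (e (a + s • w) - e a)) = s⁻¹ * ((S (a + s • w) (F t x) - S a (F t x)) -
          (S (a + s • w) x - S a x) - t * (e (a + s • w) - e a)) := by ring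
    rw [Real.dist_eq, h2, abs_mul, abs_of_pos (inv_pos.2 hs0), inv_mul_le_iff₀ hs0]
    linarith
  have h1 := hR t x
  have h2 := (hR 1 0).const_mul t
  simp only [one_mul] at h2
  have h3 := tendsto_nhds_unique h1 h2
  rw [inner_add_left, inner_smul_left, inner_sub_left]
  simp only [conj_trivial]
  linarith

/-- At a regular parameter, the flow on the leaf is uniformly Lipschitz: `D(F t)` is the ratio of
the derivatives of `paramGradient S a` at the two ends of the orbit. -/
theorem lipschitzWith_flow (H : IsGradientFamily U η S K) {a : Euc n} (haU : a ∈ U)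
    (ha : IsRegular η S a) {F : ℝ → Euc n → Euc n} (hF0 : ∀ x, F 0 x = x)
    (hFadd : ∀ s t x, F (s + t) x = F s (F t x)) (hFL : ∀ t, ∃ C, LipschitzWith C (F t))
    {ω : Euc n} (hω : ∀ t x, paramGradient S a (F t x) = paramGradient S a x + t • ω)
    {M : ℝ≥0} (hM : K ^ 2 ≤ M) (t : ℝ) : LipschitzWith M (F t) := by
  have hK := H.pos
  let ν : Measure (Euc n) := μH[(Module.finrank ℝ (Euc n) : ℝ)]
  have hν : ν.IsAddHaarMeasure := isAddHaarMeasure_hausdorffMeasure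
  have hgood : ∀ᵐ x ∂ν, DifferentiableAt ℝ (paramGradient S a) x ∧
      ∀ v, ‖v‖ ≤ K * ‖fderiv ℝ (paramGradient S a) x v‖ :=
    (Measure.absolutelyContinuous_isAddHaarMeasure ν volume).ae_le
      (H.ae_norm_le_fderiv_paramGradient haU ha)
  obtain ⟨C, hC⟩ := hFL t
  obtain ⟨C', hC'⟩ := hFL (-t)
  have hgood' : ∀ᵐ x ∂ν, DifferentiableAt ℝ (paramGradient S a) (F t x) ∧
      ∀ v, ‖v‖ ≤ K * ‖fderiv ℝ (paramGradient S a) (F t x) v‖ := by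
    have h1 : ν (F (-t) '' {x | ¬ (DifferentiableAt ℝ (paramGradient S a) x ∧
        ∀ v, ‖v‖ ≤ K * ‖fderiv ℝ (paramGradient S a) x v‖)}) = 0 := by
      refine le_antisymm ?_ zero_le
      refine (hC'.hausdorffMeasure_image_le (Nat.cast_nonneg _) _).trans ?_
      exact (mul_eq_zero.2 (Or.inr hgood)).le
    filter_upwards [measure_eq_zero_iff_ae_notMem.1 h1] with x hx
    by_contra hn
    exact hx ⟨F t x, hn, by rw [← hFadd, neg_add_cancel, hF0]⟩
  refine hC.locallyLipschitz.lipschitzWith_of_ae_fderiv_le (μ := ν) ?_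
  filter_upwards [hgood, hgood', hC.ae_differentiableAt (μ := ν)] with x h1 h2 h3
  refine ⟨_, h3.hasFDerivAt, ContinuousLinearMap.opNorm_le_bound _ M.2 fun v => ?_⟩
  have h4 : HasFDerivAt (paramGradient S a ∘ F t) (fderiv ℝ (paramGradient S a) x) x := by
    have h5 : paramGradient S a ∘ F t = fun x => paramGradient S a x + t • ω := by
      ext1 x
      exact hω t x
    rw [h5]
    exact h1.1.hasFDerivAt.add_const _
  have h5 := (h2.1.hasFDerivAt.comp x h3.hasFDerivAt).unique h4
  have h6 := h2.2 (fderiv ℝ (F t) x v)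
  rw [← ContinuousLinearMap.comp_apply, h5] at h6
  have h7 : ‖fderiv ℝ (paramGradient S a) x v‖ ≤ K * ‖v‖ := by
    refine (ContinuousLinearMap.le_opNorm _ _).trans ?_
    gcongr
    have := norm_fderiv_le_of_lipschitz ℝ (H.lipschitzWith_paramGradient haU ha) (x₀ := x)
    rwa [Real.coe_toNNReal _ hK.le] at this
  calc _ ≤ K * ‖fderiv ℝ (paramGradient S a) x v‖ := h6
    _ ≤ K * (K * ‖v‖) := by gcongr
    _ = K ^ 2 * ‖v‖ := by ring
    _ ≤ M * ‖v‖ := by gcongr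

theorem exists_isLipschitzSemiconj (H : IsGradientFamily U η S K) {a : Euc n} (haU : a ∈ U)
    (ha : IsRegular η S a) {F : ℝ → Euc n → Euc n} (hF0 : ∀ x, F 0 x = x)
    (hFadd : ∀ s t x, F (s + t) x = F s (F t x))
    (hFper : ∀ t x, ∀ m ∈ intLattice n, F t (x + m) = F t x + m)
    (hFL : ∀ t, ∃ C, LipschitzWith C (F t)) {X : Euc n → Euc n}
    (hF : ∀ t x, HasDerivAt (fun t => F t x) (X (F t x)) t) {e : Euc n → ℝ} {C : ℝ}
    (he : ∀ᶠ b in 𝓝 a, ∀ x, |e b - e a - inner ℝ (η b x - η a x) (X x)| ≤ C * ‖b - a‖ ^ 2)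
    {M : ℝ≥0} (hM : K ^ 2 ≤ M) : ∃ h ω, IsLipschitzSemiconj F h ω M := by
  obtain ⟨ω, hω⟩ := H.exists_paramGradient_flow haU ha hF0 hF he
  obtain ⟨T, hT, hTper⟩ := H.paramGradient_add haU ha
  have hK := H.pos
  have hinj : Function.Injective T := by
    refine (injective_iff_map_eq_zero _).2 fun v hv => ?_
    have := hT v
    rw [hv, norm_zero, mul_zero] at this
    exact norm_le_zero_iff.1 this
  let A : Euc n ≃ₗ[ℝ] Euc n := LinearEquiv.ofInjectiveEndo T.toLinearMap hinj
  have hA : ∀ v, A v = T v := fun _ => rfl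
  have hAs : ∀ v, ‖A.symm v‖ ≤ K * ‖v‖ := fun v => by
    have := hT (A.symm v)
    rwa [← hA, A.apply_symm_apply] at this
  refine ⟨fun x => A.symm (paramGradient S a x), A.symm ω, hF0, hFadd, hFper,
    H.lipschitzWith_flow haU ha hF0 hFadd hFL hω hM, ?_, fun x m hm => ?_, fun t x => ?_⟩
  · refine LipschitzWith.of_dist_le_mul fun x y => ?_
    rw [dist_eq_norm, dist_eq_norm, ← map_sub]
    have h1 := (H.lipschitzWith_paramGradient haU ha).norm_sub_le x y
    rw [Real.coe_toNNReal _ hK.le] at h1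
    calc _ ≤ K * ‖paramGradient S a x - paramGradient S a y‖ := hAs _
      _ ≤ K * (K * ‖x - y‖) := by gcongr
      _ = K ^ 2 * ‖x - y‖ := by ring
      _ ≤ M * ‖x - y‖ := by gcongr
  · simp only [hTper x m hm, map_add, ← hA, A.symm_apply_apply]
  · simp only [hω, map_add, map_smul]

end IsGradientFamily

/-- Lipschitz semiconjugacies with a uniform constant pass to limits of flows. -/
theorem IsLipschitzSemiconj.exists_of_tendsto {Fk : ℕ → ℝ → Euc n → Euc n}
    {F : ℝ → Euc n → Euc n} {M : ℝ≥0} (hk : ∀ k, ∃ h ω, IsLipschitzSemiconj (Fk k) h ω M)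
    (hlim : ∀ t x, Tendsto (fun k => Fk k t x) atTop (𝓝 (F t x))) (hF0 : ∀ x, F 0 x = x)
    (hFadd : ∀ s t x, F (s + t) x = F s (F t x))
    (hFper : ∀ t x, ∀ m ∈ intLattice n, F t (x + m) = F t x + m) :
    ∃ h ω, IsLipschitzSemiconj F h ω M := by
  choose h ω H using hk
  let 𝒲 : Ultrafilter ℕ := hyperfilter ℕ
  have h𝒲 : (𝒲 : Filter ℕ) ≤ atTop := Nat.hyperfilter_le_atTop
  have hex : ∀ x, ∃ y, Tendsto (fun k => h k x - h k 0) 𝒲 (𝓝 y) := by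
    intro x
    obtain ⟨y, -, hy⟩ := (isCompact_closedBall (0 : Euc n) (M * ‖x‖)).exists_tendsto_ultrafilter 𝒲
      (f := fun k => h k x - h k 0) (Eventually.of_forall fun k => by
        have := (H k).lipschitz_semiconj.norm_sub_le x 0
        rw [sub_zero] at this
        exact mem_closedBall_zero_iff.2 this)
    exact ⟨y, hy⟩
  choose g hg using hex
  have hflow : ∀ t x, Tendsto (fun k => t • ω k) 𝒲 (𝓝 (g (F t x) - g x)) := by
    intro t x
    have h1 : Tendsto (fun k => h k (Fk k t x) - h k (F t x)) 𝒲 (𝓝 0) := by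
      rw [tendsto_zero_iff_norm_tendsto_zero]
      have h2 : Tendsto (fun k => M * ‖Fk k t x - F t x‖) 𝒲 (𝓝 0) := by
        have := (tendsto_iff_norm_sub_tendsto_zero.1 ((hlim t x).mono_left h𝒲)).const_mul (M : ℝ)
        rwa [mul_zero] at this
      exact squeeze_zero (fun _ => norm_nonneg _)
        (fun k => (H k).lipschitz_semiconj.norm_sub_le _ _) h2
    have h3 := h1.add ((hg (F t x)).sub (hg x))
    rw [zero_add] at h3
    refine h3.congr fun k => ?_
    rw [(H k).semiconj]
    abel
  refine ⟨g, g (F 1 0) - g 0, hF0, hFadd, hFper, fun t => ?_, ?_, fun x m hm => ?_, fun t x => ?_⟩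
  · exact LipschitzWith.of_dist_le_mul fun x y =>
      le_of_tendsto' ((hlim t x).dist (hlim t y)) fun k => ((H k).lipschitz t).dist_le_mul x y
  · refine LipschitzWith.of_dist_le_mul fun x y => ?_
    refine le_of_tendsto' ((hg x).dist (hg y)) fun k => ?_
    rw [dist_sub_right]
    exact (H k).lipschitz_semiconj.dist_le_mul x y
  · refine tendsto_nhds_unique (hg (x + m)) (((hg x).add_const m).congr fun k => ?_)
    rw [(H k).semiconj_add x m hm]
    abel
  · have h1 := hflow t x
    have h2 := (hflow 1 0).const_smul t
    simp only [one_smul] at h2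
    rw [← tendsto_nhds_unique h1 h2]
    abel

/-! ### Flows of Lipschitz vector fields -/

/-- `F` is the flow of the vector field `X`: each `t ↦ F t x` is the integral curve from `x`. -/
structure IsFlowOf {E : Type*} [NormedAddCommGroup E] [NormedSpace ℝ E] (X : E → E)
    (F : ℝ → E → E) : Prop where
  zero : ∀ x, F 0 x = x
  hasDerivAt : ∀ t x, HasDerivAt (fun t => F t x) (X (F t x)) t

namespace IsFlowOf

variable {E : Type*} [NormedAddCommGroup E] [NormedSpace ℝ E] {X Y : E → E} {F G : ℝ → E → E}
  {C : ℝ≥0}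

theorem continuous_time (hF : IsFlowOf X F) (x : E) : Continuous fun t => F t x :=
  continuous_iff_continuousAt.2 fun t => (hF.hasDerivAt t x).continuousAt

theorem neg (hF : IsFlowOf X F) : IsFlowOf (fun x => -X x) fun t => F (-t) where
  zero x := by rw [neg_zero, hF.zero]
  hasDerivAt t x := by
    have h := (hF.hasDerivAt (-t) x).scomp t (hasDerivAt_neg t)
    rw [neg_one_smul] at h
    exact h

theorem eq_of_hasDerivAt (hX : LipschitzWith C X) (hF : IsFlowOf X F) {y : ℝ → E}
    (hy : ∀ t, HasDerivAt y (X (y t)) t) (t : ℝ) : y t = F t (y 0) := by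
  have := ODE_solution_unique_univ (v := fun _ => X) (s := fun _ => univ) (K := C) (t₀ := 0)
    (fun _ => hX.lipschitzOnWith) (fun t => ⟨hy t, mem_univ _⟩)
    (fun t => ⟨hF.hasDerivAt t (y 0), mem_univ _⟩) (hF.zero _).symm
  exact congrFun this t

theorem add (hX : LipschitzWith C X) (hF : IsFlowOf X F) (s t : ℝ) (x : E) :
    F (s + t) x = F s (F t x) := by
  have := hF.eq_of_hasDerivAt hX (y := fun s => F (s + t) x)
    (fun s => (hF.hasDerivAt (s + t) x).comp_add_const s t) s
  simpa using this

theorem map_add (hX : LipschitzWith C X) (hF : IsFlowOf X F) {m : E} (hm : ∀ x, X (x + m) = X x)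
    (t : ℝ) (x : E) : F t (x + m) = F t x + m := by
  have := hF.eq_of_hasDerivAt hX (y := fun t => F t x + m)
    (fun t => by rw [hm]; exact (hF.hasDerivAt t x).add_const m) t
  rw [hF.zero] at this
  exact this.symm

/-- Comparison of the flows of two vector fields at bounded distance, for positive times. -/
theorem dist_le_gronwallBound (hX : LipschitzWith C X) (hF : IsFlowOf X F) (hG : IsFlowOf Y G)
    {ε : ℝ} (hXY : ∀ x, dist (Y x) (X x) ≤ ε) {t : ℝ} (ht : 0 ≤ t) (x y : E) :
    dist (G t x) (F t y) ≤ gronwallBound (dist x y) C ε t := by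
  have := dist_le_of_approx_trajectories_ODE (v := fun _ => X) (K := C) (a := 0) (b := t)
    (fun _ => hX) (hG.continuous_time x).continuousOn
    (fun s _ => (hG.hasDerivAt s x).hasDerivWithinAt) (fun s _ => hXY (G s x))
    (hF.continuous_time y).continuousOn (fun s _ => (hF.hasDerivAt s y).hasDerivWithinAt)
    (εg := 0) (fun s _ => (dist_self _).le) (δ := dist x y) (by simp only [hF.zero, hG.zero]; rfl) t ⟨ht, le_rfl⟩
  simpa using this

theorem dist_le_gronwallBound_abs (hX : LipschitzWith C X) (hF : IsFlowOf X F)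
    (hG : IsFlowOf Y G) {ε : ℝ} (hXY : ∀ x, dist (Y x) (X x) ≤ ε) (t : ℝ) (x y : E) :
    dist (G t x) (F t y) ≤ gronwallBound (dist x y) C ε |t| := by
  rcases le_total 0 t with ht | ht
  · rw [abs_of_nonneg ht]
    exact dist_le_gronwallBound hX hF hG hXY ht x y
  · rw [abs_of_nonpos ht]
    have hX' : LipschitzWith C fun x => -X x := hX.neg
    have := dist_le_gronwallBound hX' hF.neg hG.neg (ε := ε)
      (fun x => by rw [dist_neg_neg]; exact hXY x) (neg_nonneg.2 ht) x y
    simpa using this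

theorem dist_le (hX : LipschitzWith C X) (hF : IsFlowOf X F) (t : ℝ) (x y : E) :
    dist (F t x) (F t y) ≤ Real.exp (C * |t|) * dist x y := by
  have := dist_le_gronwallBound_abs hX hF hF (ε := 0) (fun x => (dist_self _).le) t x y
  rwa [gronwallBound_ε0, mul_comm] at this

theorem exists_lipschitzWith (hX : LipschitzWith C X) (hF : IsFlowOf X F) (t : ℝ) :
    ∃ C', LipschitzWith C' (F t) :=
  ⟨⟨Real.exp (C * |t|), (Real.exp_pos _).le⟩, LipschitzWith.of_dist_le_mul (hF.dist_le hX t)⟩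

theorem continuous (hX : LipschitzWith C X) (hF : IsFlowOf X F) :
    Continuous fun z : ℝ × E => F z.1 z.2 := by
  rw [continuous_iff_continuousAt]
  rintro ⟨t, x⟩
  rw [ContinuousAt, tendsto_iff_dist_tendsto_zero]
  have h1 : Tendsto (fun z : ℝ × E => Real.exp (C * |z.1|) * dist z.2 x + dist (F z.1 x) (F t x))
      (𝓝 (t, x)) (𝓝 0) := by
    have hc := hF.continuous_time x
    have : Continuous fun z : ℝ × E =>
        Real.exp (C * |z.1|) * dist z.2 x + dist (F z.1 x) (F t x) := by fun_prop
    simpa using this.tendsto (t, x)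
  refine squeeze_zero (fun _ => dist_nonneg) (fun z => ?_) h1
  exact (dist_triangle _ (F z.1 x) _).trans (add_le_add (hF.dist_le hX _ _ _) le_rfl)

/-- The flow depends continuously on the vector field, for uniform convergence. -/
theorem tendsto {ι : Type*} {l : Filter ι} (hX : LipschitzWith C X) (hF : IsFlowOf X F)
    {Y : ι → E → E} {G : ι → ℝ → E → E} (hG : ∀ᶠ i in l, IsFlowOf (Y i) (G i)) {ε : ι → ℝ}
    (hε : Tendsto ε l (𝓝 0)) (hXY : ∀ᶠ i in l, ∀ x, dist (Y i x) (X x) ≤ ε i) (t : ℝ) (x : E) :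
    Tendsto (fun i => G i t x) l (𝓝 (F t x)) := by
  rw [tendsto_iff_dist_tendsto_zero]
  have h1 := ((gronwallBound_continuous_ε 0 C |t|).tendsto 0).comp hε
  rw [gronwallBound_ε0_δ0] at h1
  refine squeeze_zero' (.of_forall fun _ => dist_nonneg) ?_ h1
  filter_upwards [hG, hXY] with i h2 h3
  have := dist_le_gronwallBound_abs hX hF h2 h3 t x x
  rwa [dist_self] at this

end IsFlowOf

/-! ### The torus and its universal cover -/

theorem continuous_toTorus : Continuous (toTorus (n := n)) := continuous_quot_mk

theorem surjective_toTorus : Function.Surjective (toTorus (n := n)) := QuotientAddGroup.mk_surjective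

theorem toTorus_add (x y : Euc n) : toTorus (x + y) = toTorus x + toTorus y := rfl

theorem toTorus_sub (x y : Euc n) : toTorus (x - y) = toTorus x - toTorus y := rfl

theorem toTorus_eq_zero {x : Euc n} : toTorus x = 0 ↔ x ∈ intLattice n :=
  QuotientAddGroup.eq_zero_iff x

theorem toTorus_add_of_mem (x : Euc n) {m : Euc n} (hm : m ∈ intLattice n) :
    toTorus (x + m) = toTorus x := by
  rw [toTorus_add, toTorus_eq_zero.2 hm, add_zero]

theorem toTorus_eq {x y : Euc n} : toTorus x = toTorus y ↔ ∃ m ∈ intLattice n, x = y + m := by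
  rw [← sub_eq_zero, ← toTorus_sub, toTorus_eq_zero]
  exact ⟨fun h => ⟨x - y, h, by abel⟩, fun ⟨m, hm, h⟩ => by rwa [h, add_sub_cancel_left]⟩

theorem dist_toTorus_le (x y : Euc n) : dist (toTorus x) (toTorus y) ≤ ‖x - y‖ := by
  rw [dist_eq_norm, ← toTorus_sub]
  exact QuotientAddGroup.norm_mk_le_norm

theorem exists_norm_sub_lt_dist_add (q q' : Torus n) {ε : ℝ} (hε : 0 < ε) :
    ∃ x x', toTorus x = q ∧ toTorus x' = q' ∧ ‖x - x'‖ < dist q q' + ε := by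
  obtain ⟨y, rfl⟩ := surjective_toTorus q'
  obtain ⟨v, hv, hn⟩ := QuotientAddGroup.exists_norm_mk_lt (q - toTorus y) hε
  refine ⟨y + v, y, ?_, rfl, ?_⟩
  · rw [toTorus_add]
    change toTorus v = _ at hv
    rw [hv, add_sub_cancel]
  · rwa [add_sub_cancel_left, dist_eq_norm]

/-! ### The Hamiltonian vector field on the cover -/

/-- The preimage in `ℝⁿ × ℝⁿ` of a subset of the cotangent bundle. -/
def coverSet (V : Set (CotTorus n)) : Set (Euc n × Euc n) :=
  {z | (toTorus z.1, z.2) ∈ V}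

variable {H : CotTorus n → ℝ} {V : Set (CotTorus n)}

theorem isOpen_coverSet (hV : IsOpen V) : IsOpen (coverSet V) :=
  hV.preimage ((continuous_toTorus.comp continuous_fst).prodMk continuous_snd)

theorem liftHam_add (x p : Euc n) {m : Euc n} (hm : m ∈ intLattice n) :
    liftHam H (x + m, p) = liftHam H (x, p) := by
  simp only [liftHam, toTorus_add_of_mem x hm]

theorem hamVF_add (x p : Euc n) {m : Euc n} (hm : m ∈ intLattice n) :
    hamVF H (x + m, p) = hamVF H (x, p) := by
  simp only [hamVF, liftHam_add _ _ hm]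
  congr 2
  have h1 : (fun y => liftHam H (y, p)) = fun y => liftHam H (y + m, p) := by
    ext y
    rw [liftHam_add _ _ hm]
  simp only [gradient]
  conv_rhs => rw [h1]
  exact congrArg _ (fderiv_comp_add_right (f := fun y => liftHam H (y, p)) m).symm

theorem hasFDerivAt_liftHam (hV : IsOpen V) (hH : IsC2On H V) {z : Euc n × Euc n}
    (hz : z ∈ coverSet V) : HasFDerivAt (liftHam H) (fderiv ℝ (liftHam H) z) z :=
  ((hH.contDiffAt ((isOpen_coverSet hV).mem_nhds hz)).differentiableAt (by simp)).hasFDerivAt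

theorem hasFDerivAt_liftHam_momentum (hV : IsOpen V) (hH : IsC2On H V) {z : Euc n × Euc n}
    (hz : z ∈ coverSet V) : HasFDerivAt (fun p => liftHam H (z.1, p))
      ((fderiv ℝ (liftHam H) z).comp (ContinuousLinearMap.inr ℝ _ _)) z.2 :=
  HasFDerivAt.comp (g := liftHam H) (f := fun p => (z.1, p)) z.2
    (hasFDerivAt_liftHam hV hH (z := (z.1, z.2)) hz) (hasFDerivAt_prodMk_right z.1 z.2)

theorem hasFDerivAt_liftHam_position (hV : IsOpen V) (hH : IsC2On H V) {z : Euc n × Euc n}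
    (hz : z ∈ coverSet V) : HasFDerivAt (fun x => liftHam H (x, z.2))
      ((fderiv ℝ (liftHam H) z).comp (ContinuousLinearMap.inl ℝ _ _)) z.1 :=
  HasFDerivAt.comp (g := liftHam H) (f := fun x => (x, z.2)) z.1
    (hasFDerivAt_liftHam hV hH (z := (z.1, z.2)) hz) (hasFDerivAt_prodMk_left z.1 z.2)

theorem hamVF_eq (hV : IsOpen V) (hH : IsC2On H V) {z : Euc n × Euc n} (hz : z ∈ coverSet V) :
    hamVF H z = ((InnerProductSpace.toDual ℝ _).symm
        ((fderiv ℝ (liftHam H) z).comp (ContinuousLinearMap.inr ℝ _ _)),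
      -(InnerProductSpace.toDual ℝ _).symm
        ((fderiv ℝ (liftHam H) z).comp (ContinuousLinearMap.inl ℝ _ _))) := by
  simp only [hamVF, gradient]
  rw [(hasFDerivAt_liftHam_momentum hV hH hz).fderiv, (hasFDerivAt_liftHam_position hV hH hz).fderiv]

theorem fderiv_liftHam_apply (hV : IsOpen V) (hH : IsC2On H V) {z : Euc n × Euc n}
    (hz : z ∈ coverSet V) (u v : Euc n) : fderiv ℝ (liftHam H) z (u, v) =
      -inner ℝ (hamVF H z).2 u + inner ℝ (hamVF H z).1 v := by
  rw [hamVF_eq hV hH hz]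
  simp only [inner_neg_left, neg_neg, InnerProductSpace.toDual_symm_apply,
    ContinuousLinearMap.comp_apply, ContinuousLinearMap.inl_apply, ContinuousLinearMap.inr_apply]
  rw [← map_add, Prod.mk_add_mk, add_zero, zero_add]

theorem locallyLipschitzOn_hamVF (hV : IsOpen V) (hH : IsC2On H V) :
    LocallyLipschitzOn (coverSet V) (hamVF H) := by
  intro z hz
  have hd : ContDiffOn ℝ 1 (fderiv ℝ (liftHam H)) (coverSet V) :=
    hH.fderiv_of_isOpen (isOpen_coverSet hV) (by norm_num)
  have hc : ContDiffOn ℝ 1 (hamVF H) (coverSet V) := by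
    refine ContDiffOn.congr ?_ fun z hz => hamVF_eq hV hH hz
    refine ContDiffOn.prodMk ?_ ?_
    · exact (InnerProductSpace.toDual ℝ (Euc n)).symm.toContinuousLinearEquiv.contDiff.comp_contDiffOn
        (hd.clm_comp contDiffOn_const)
    · exact ((InnerProductSpace.toDual ℝ (Euc n)).symm.toContinuousLinearEquiv.contDiff.comp_contDiffOn
        (hd.clm_comp contDiffOn_const)).neg
  obtain ⟨K, t, ht, hK⟩ :=
    (hc.contDiffAt ((isOpen_coverSet hV).mem_nhds hz)).exists_lipschitzOnWith
  exact ⟨K, t, mem_nhdsWithin_of_mem_nhds ht, hK⟩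

theorem eq_of_hasDerivAt_hamVF (hV : IsOpen V) (hH : IsC2On H V) {c c' : ℝ → Euc n × Euc n}
    (hc : ∀ t, HasDerivAt c (hamVF H (c t)) t) (hcV : ∀ t, c t ∈ coverSet V)
    (hc' : ∀ t, HasDerivAt c' (hamVF H (c' t)) t) (hcV' : ∀ t, c' t ∈ coverSet V)
    (h0 : c 0 = c' 0) : c = c' := by
  have hcc : Continuous c := continuous_iff_continuousAt.2 fun t => (hc t).continuousAt
  have hcc' : Continuous c' := continuous_iff_continuousAt.2 fun t => (hc' t).continuousAt
  ext1 t
  have ht : t ∈ Icc (-(|t| + 1)) (|t| + 1) :=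
    ⟨by linarith [neg_abs_le t], by linarith [le_abs_self t]⟩
  have h0' : (0 : ℝ) ∈ Ioo (-(|t| + 1)) (|t| + 1) :=
    ⟨by linarith [abs_nonneg t], by linarith [abs_nonneg t]⟩
  let Z := c '' Icc (-(|t| + 1)) (|t| + 1) ∪ c' '' Icc (-(|t| + 1)) (|t| + 1)
  have hZ : IsCompact Z := (isCompact_Icc.image hcc).union (isCompact_Icc.image hcc')
  have hZV : Z ⊆ coverSet V := by
    rintro z (⟨s, -, rfl⟩ | ⟨s, -, rfl⟩)
    exacts [hcV s, hcV' s]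
  obtain ⟨C, hC⟩ := ((locallyLipschitzOn_hamVF hV hH).mono hZV).exists_lipschitzOnWith_of_compact hZ
  exact ODE_solution_unique_of_mem_Icc (v := fun _ => hamVF H) (s := fun _ => Z) (K := C)
    (fun _ _ => hC) h0' hcc.continuousOn (fun s _ => hc s)
    (fun s hs => Or.inl ⟨s, Ioo_subset_Icc_self hs, rfl⟩) hcc'.continuousOn (fun s _ => hc' s)
    (fun s hs => Or.inr ⟨s, Ioo_subset_Icc_self hs, rfl⟩) h0 ht

theorem hasDerivAt_add_intLattice {c : ℝ → Euc n × Euc n} {m : Euc n} (hm : m ∈ intLattice n)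
    (hc : ∀ t, HasDerivAt c (hamVF H (c t)) t) (t : ℝ) :
    HasDerivAt (fun t => c t + (m, 0)) (hamVF H (c t + (m, 0))) t := by
  have h1 : hamVF H (c t + (m, 0)) = hamVF H (c t) := by
    have := hamVF_add (H := H) (c t).1 (c t).2 hm
    rwa [← add_zero (c t).2, ← Prod.mk_add_mk, add_zero] at this
  rw [h1]
  exact (hc t).add_const _

theorem IsHamCurve.unique (hV : IsOpen V) (hH : IsC2On H V) {γ γ' : ℝ → CotTorus n}
    (h : IsHamCurve H V γ) (h' : IsHamCurve H V γ') (h0 : γ 0 = γ' 0) : γ = γ' := by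
  obtain ⟨hγ, c, hγc, hc⟩ := h
  obtain ⟨hγ', c', hγc', hc'⟩ := h'
  rw [hγc, hγc', Prod.mk.injEq] at h0
  obtain ⟨m, hm, hx⟩ := toTorus_eq.1 h0.1
  have he : c = fun t => c' t + (m, 0) := by
    refine eq_of_hasDerivAt_hamVF hV hH hc (fun t => ?_) (hasDerivAt_add_intLattice hm hc')
      (fun t => ?_) ?_
    · change (toTorus (c t).1, (c t).2) ∈ V
      rw [← hγc]
      exact hγ t
    · change (toTorus ((c' t).1 + m), (c' t).2 + 0) ∈ V
      rw [toTorus_add_of_mem _ hm, add_zero, ← hγc']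
      exact hγ' t
    · exact Prod.ext hx (by simpa using h0.2)
  ext1 t
  rw [hγc, hγc', he]
  simp [toTorus_add_of_mem _ hm]

/-! ### The leaves of the foliation, on the cover -/

variable {𝒰 : Set (CotTorus n)} {U : Set (Euc n)} {η : Euc n → Torus n → Euc n}

/-- The lift to `ℝⁿ` of the map `η a` whose graph is the leaf. -/
def liftLeaf (η : Euc n → Torus n → Euc n) (a x : Euc n) : Euc n := η a (toTorus x)

/-- The vector field on `ℝⁿ` which is the projection of the Hamiltonian vector field on the leaf. -/
noncomputable def leafField (H : CotTorus n → ℝ) (η : Euc n → Torus n → Euc n) (a x : Euc n) :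
    Euc n :=
  (hamVF H (x, liftLeaf η a x)).1

theorem liftLeaf_add (a x : Euc n) {m : Euc n} (hm : m ∈ intLattice n) :
    liftLeaf η a (x + m) = liftLeaf η a x := by
  rw [liftLeaf, toTorus_add_of_mem x hm, liftLeaf]

theorem leafField_add (a x : Euc n) {m : Euc n} (hm : m ∈ intLattice n) :
    leafField H η a (x + m) = leafField H η a x := by
  rw [leafField, liftLeaf_add a x hm, hamVF_add _ _ hm, leafField]

namespace IsGLipschitzIntegrable

theorem mem_coverSet (hH : IsGLipschitzIntegrable H V 𝒰 U η) {a : Euc n} (ha : a ∈ U)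
    (x : Euc n) : (x, liftLeaf η a x) ∈ coverSet V := by
  obtain ⟨A, -, -, hA⟩ := hH.inverse
  exact hH.subset (hA a ha (toTorus x)).1

theorem exists_lipschitzWith_liftLeaf (hH : IsGLipschitzIntegrable H V 𝒰 U η) {a : Euc n}
    (ha : a ∈ U) : ∃ C, LipschitzWith C (liftLeaf η a) := by
  obtain ⟨C, hC⟩ := (hH.lagrangian a ha).1
  refine ⟨C, LipschitzWith.of_dist_le_mul fun x y => (hC.dist_le_mul _ _).trans ?_⟩
  gcongr
  rw [dist_eq_norm x]
  exact dist_toTorus_le x y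

theorem exists_leafCurve (hH : IsGLipschitzIntegrable H V 𝒰 U η) {a : Euc n} (ha : a ∈ U)
    (x : Euc n) : ∃ c : ℝ → Euc n × Euc n, c 0 = (x, liftLeaf η a x) ∧
      (∀ t, HasDerivAt c (hamVF H (c t)) t) ∧ ∀ t, (c t).2 = liftLeaf η a (c t).1 := by
  obtain ⟨γ, ⟨-, c, hγc, hc⟩, hγ0, hγ⟩ := hH.invariant a ha (toTorus x, η a (toTorus x)) ⟨_, rfl⟩
  have hgraph : ∀ t, (c t).2 = liftLeaf η a (c t).1 := by
    intro t
    obtain ⟨q, hq⟩ := hγ t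
    rw [hγc, Prod.mk.injEq] at hq
    rw [← hq.2, liftLeaf, hq.1]
  rw [hγc, Prod.mk.injEq] at hγ0
  obtain ⟨m, hm, hx⟩ := toTorus_eq.1 hγ0.1.symm
  refine ⟨fun t => c t + (m, 0), ?_, hasDerivAt_add_intLattice hm hc, fun t => ?_⟩
  · refine Prod.ext hx.symm ?_
    simp [hγ0.2, liftLeaf]
  · simp [hgraph t, liftLeaf_add _ _ hm]

/-- The Hamiltonian flow on a leaf, lifted to `ℝⁿ`, is the flow of the field `leafField`. -/
theorem exists_leafFlow (hH : IsGLipschitzIntegrable H V 𝒰 U η) {a : Euc n} (ha : a ∈ U) :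
    ∃ F : ℝ → Euc n → Euc n, IsFlowOf (leafField H η a) F ∧
      (∀ x, HasDerivAt (fun t => liftLeaf η a (F t x)) (hamVF H (x, liftLeaf η a x)).2 0) ∧
      ∀ t x, hamFlow H V t (toTorus x, η a (toTorus x)) =
        (toTorus (F t x), η a (toTorus (F t x))) := by
  choose c h0 hc hg using hH.exists_leafCurve ha
  have hc' : ∀ x t, c x t = ((c x t).1, liftLeaf η a (c x t).1) := fun x t =>
    Prod.ext rfl (hg x t)
  refine ⟨fun t x => (c x t).1, ⟨fun x => by rw [h0], fun t x => ?_⟩, fun x => ?_, fun t x => ?_⟩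
  · have h : HasDerivAt (fun t => (c x t).1) (hamVF H (c x t)).1 t :=
      (ContinuousLinearMap.fst ℝ (Euc n) (Euc n)).hasFDerivAt.comp_hasDerivAt t (hc x t)
    have e : (hamVF H (c x t)).1 = leafField H η a (c x t).1 := by rw [leafField, ← hc']
    rwa [e] at h
  · have h : HasDerivAt (fun t => (c x t).2) (hamVF H (c x 0)).2 0 :=
      (ContinuousLinearMap.snd ℝ (Euc n) (Euc n)).hasFDerivAt.comp_hasDerivAt 0 (hc x 0)
    rw [h0] at h
    simpa only [hg] using h
  · have hcurve : IsHamCurve H V fun t => (toTorus (c x t).1, (c x t).2) := by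
      refine ⟨fun t => ?_, c x, fun _ => rfl, hc x⟩
      have := hH.mem_coverSet ha (c x t).1
      rwa [← hc' x t] at this
    have hz : (toTorus (c x 0).1, (c x 0).2) = (toTorus x, η a (toTorus x)) := by
      rw [h0]
      rfl
    have hex : ∃ γ, IsHamCurve H V γ ∧ γ 0 = (toTorus x, η a (toTorus x)) := ⟨_, hcurve, hz⟩
    rw [hamFlow, dif_pos hex, hex.choose_spec.1.unique hH.isOpen_V hH.isC2 hcurve
      (hex.choose_spec.2.trans hz.symm)]
    exact Prod.ext rfl (hg x t)

/-- Near a leaf, at bounded height, the Hamiltonian vector field is defined and Lipschitz, with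
constants that do not depend on the point of the torus. -/
theorem exists_uniform (hH : IsGLipschitzIntegrable H V 𝒰 U η) {a : Euc n} (ha : a ∈ U) :
    ∃ δ > 0, ∃ L : ℝ, 0 ≤ L ∧ ∀ x p, ‖p - liftLeaf η a x‖ ≤ δ → (x, p) ∈ coverSet V ∧
      ∀ x' p', ‖p' - liftLeaf η a x'‖ ≤ δ →
        ‖(hamVF H (x, p)).1 - (hamVF H (x', p')).1‖ ≤ L * (‖x - x'‖ + ‖p - p'‖) := by
  obtain ⟨C, hC⟩ := hH.exists_lipschitzWith_liftLeaf ha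
  let Γ : Set (Euc n × Euc n) := (fun x => (x, liftLeaf η a x)) '' Metric.closedBall 0 (√n + 1)
  have hΓ : IsCompact Γ := (isCompact_closedBall _ _).image (continuous_id.prodMk hC.continuous)
  have hΓV : Γ ⊆ coverSet V := by
    rintro _ ⟨x, -, rfl⟩
    exact hH.mem_coverSet ha x
  obtain ⟨δ, hδ, hδV⟩ := hΓ.exists_cthickening_subset_open (isOpen_coverSet hH.isOpen_V) hΓV
  have hZ : IsCompact (Metric.cthickening δ Γ) := hΓ.cthickening
  obtain ⟨L, hL⟩ := ((locallyLipschitzOn_hamVF hH.isOpen_V hH.isC2).mono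
    hδV).exists_lipschitzOnWith_of_compact hZ
  obtain ⟨B, hB⟩ := (hZ.image_of_continuousOn
    hL.continuousOn).isBounded.exists_norm_le
  have hB' : ∀ z ∈ Metric.cthickening δ Γ, ‖(hamVF H z).1‖ ≤ max B 0 := fun z hz =>
    (norm_fst_le _).trans ((hB _ (mem_image_of_mem _ hz)).trans (le_max_left _ _))
  have hmem : ∀ x p, ‖x‖ ≤ √n + 1 → ‖p - liftLeaf η a x‖ ≤ δ →
      (x, p) ∈ Metric.cthickening δ Γ := by
    intro x p hx hp
    refine Metric.mem_cthickening_of_dist_le _ (x, liftLeaf η a x) _ _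
      ⟨x, by simpa using hx, rfl⟩ ?_
    rw [Prod.dist_eq, dist_self, dist_eq_norm]
    exact max_le hδ.le hp
  refine ⟨δ, hδ, max (L : ℝ) (2 * max B 0), by positivity, fun x p hp => ?_⟩
  -- both points are translated so that the first one is in a fixed bounded domain
  obtain ⟨m, hm, hxm⟩ := exists_intLattice_near x
  have hm' := neg_mem hm
  have hleaf : ∀ y, liftLeaf η a (y - m) = liftLeaf η a y := fun y => by
    rw [sub_eq_add_neg, liftLeaf_add _ _ hm']
  have hham : ∀ y p, hamVF H (y - m, p) = hamVF H (y, p) := fun y p => by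
    rw [sub_eq_add_neg, hamVF_add _ _ hm']
  have h1 : (x - m, p) ∈ Metric.cthickening δ Γ :=
    hmem _ _ (by linarith) (by rwa [hleaf])
  refine ⟨?_, fun x' p' hp' => ?_⟩
  · have := hδV h1
    rwa [coverSet, mem_ofPred_eq, sub_eq_add_neg, toTorus_add_of_mem _ hm'] at this
  rcases le_or_gt ‖x - x'‖ 1 with hxx | hxx
  · have h2 : (x' - m, p') ∈ Metric.cthickening δ Γ := by
      refine hmem _ _ ?_ (by rwa [hleaf])
      have : x' - m = (x - m) - (x - x') := by abel
      rw [this]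
      exact (norm_sub_le _ _).trans (add_le_add hxm hxx)
    have h3 := hL.dist_le_mul _ h1 _ h2
    rw [hham, hham, Prod.dist_eq, Prod.dist_eq, dist_eq_norm, dist_eq_norm (x - m),
      sub_sub_sub_cancel_right, dist_eq_norm p] at h3
    refine (le_max_left _ _).trans (h3.trans ?_)
    have h4 : max ‖x - x'‖ ‖p - p'‖ ≤ ‖x - x'‖ + ‖p - p'‖ :=
      max_le (by linarith [norm_nonneg (p - p')]) (by linarith [norm_nonneg (x - x')])
    gcongr
    exact le_max_left _ _
  · obtain ⟨m', hm2, hxm2⟩ := exists_intLattice_near x'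
    have hm2' := neg_mem hm2
    have hleaf' : liftLeaf η a (x' - m') = liftLeaf η a x' := by
      rw [sub_eq_add_neg, liftLeaf_add _ _ hm2']
    have h2 : (x' - m', p') ∈ Metric.cthickening δ Γ :=
      hmem _ _ (by linarith) (by rwa [hleaf'])
    have h3 := hB' _ h1
    have h4 := hB' _ h2
    rw [hham] at h3
    rw [sub_eq_add_neg, hamVF_add _ _ hm2'] at h4
    calc _ ≤ 2 * max B 0 := by linarith [norm_sub_le (hamVF H (x, p)).1 (hamVF H (x', p')).1]
      _ ≤ max (L : ℝ) (2 * max B 0) * 1 := by rw [mul_one]; exact le_max_right _ _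
      _ ≤ max (L : ℝ) (2 * max B 0) * (‖x - x'‖ + ‖p - p'‖) := by
        gcongr
        linarith [norm_nonneg (p - p')]

/-- The Hamiltonian is constant on each leaf: the tangent spaces are almost everywhere Lagrangian
and contain the Hamiltonian vector field, so that the differential vanishes on them. -/
theorem liftHam_leaf_eq (hH : IsGLipschitzIntegrable H V 𝒰 U η) {a : Euc n} (ha : a ∈ U)
    (x : Euc n) : liftHam H (x, liftLeaf η a x) = liftHam H (0, liftLeaf η a 0) := by
  obtain ⟨C, hC⟩ := hH.exists_lipschitzWith_liftLeaf ha
  obtain ⟨F, hF, hF2, -⟩ := hH.exists_leafFlow ha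
  let f : Euc n → ℝ := fun x => liftHam H (x, liftLeaf η a x)
  have hpair : LipschitzWith (max 1 C) fun x => (x, liftLeaf η a x) := LipschitzWith.id.prodMk hC
  have hf : LocallyLipschitz f := by
    intro x
    have hz := hH.mem_coverSet ha x
    have h1 : ContDiffAt ℝ 1 (liftHam H) (x, liftLeaf η a x) :=
      (hH.isC2.contDiffAt ((isOpen_coverSet hH.isOpen_V).mem_nhds hz)).of_le (by norm_num)
    obtain ⟨D, t, ht, hD⟩ := h1.exists_lipschitzOnWith
    exact ⟨_, _, hpair.continuous.continuousAt ht,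
      hD.comp hpair.lipschitzOnWith (mapsTo_preimage _ _)⟩
  have hae : ∀ᵐ x, ∃ f' : Euc n →L[ℝ] ℝ, HasFDerivAt f f' x ∧ ‖f'‖ ≤ (0 : ℝ≥0) := by
    filter_upwards [hC.ae_differentiableAt (μ := volume), (hH.lagrangian a ha).2] with x hd hsym
    have hz := hH.mem_coverSet ha x
    refine ⟨0, ?_, by simp⟩
    have h1 := (hasFDerivAt_liftHam hH.isOpen_V hH.isC2 hz).comp x
      ((hasFDerivAt_id x).prodMk hd.hasFDerivAt)
    refine h1.congr_fderiv ?_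
    ext v
    -- the derivative along the flow of the relation that defines the leaf
    have h2 : (hamVF H (x, liftLeaf η a x)).2 =
        fderiv ℝ (liftLeaf η a) x (hamVF H (x, liftLeaf η a x)).1 := by
      refine (hF2 x).unique ?_
      have h3 := hF.hasDerivAt 0 x
      rw [hF.zero] at h3
      have h4 : HasFDerivAt (liftLeaf η a) (fderiv ℝ (liftLeaf η a) x) (F 0 x) := by
        rw [hF.zero]
        exact hd.hasFDerivAt
      exact h4.comp_hasDerivAt 0 h3
    change fderiv ℝ (liftHam H) (x, liftLeaf η a x) (v, fderiv ℝ (liftLeaf η a) x v) = 0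
    rw [fderiv_liftHam_apply hH.isOpen_V hH.isC2 hz, h2]
    have h5 := hsym (hamVF H (x, liftLeaf η a x)).1 v
    change inner ℝ (fderiv ℝ (liftLeaf η a) x _) v = inner ℝ _ (fderiv ℝ (liftLeaf η a) x v) at h5
    rw [h5, neg_add_cancel]
  have := (hf.lipschitzWith_of_ae_fderiv_le hae).dist_le_mul x 0
  simpa using this

variable {K : ℝ}

/-- The bi-Lipschitz estimates of the foliation, for the lifted leaves. -/
def LiftBounds (U : Set (Euc n)) (η : Euc n → Torus n → Euc n) (K : ℝ) : Prop :=
  ∀ a ∈ U, ∀ b ∈ U, ∀ x, ‖a - b‖ ≤ K * ‖liftLeaf η a x - liftLeaf η b x‖ ∧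
    ‖liftLeaf η a x - liftLeaf η b x‖ ≤ K * ‖a - b‖

theorem exists_lipschitzWith_leafField (hH : IsGLipschitzIntegrable H V 𝒰 U η) {a : Euc n}
    (ha : a ∈ U) : ∃ C, LipschitzWith C (leafField H η a) := by
  obtain ⟨C, hC⟩ := hH.exists_lipschitzWith_liftLeaf ha
  obtain ⟨δ, hδ, L, hL, h⟩ := hH.exists_uniform ha
  refine ⟨L.toNNReal * (1 + C), LipschitzWith.of_dist_le_mul fun x y => ?_⟩
  have h1 := (h x _ (by rw [sub_self, norm_zero]; exact hδ.le)).2 y _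
    (by rw [sub_self, norm_zero]; exact hδ.le)
  have h2 := hC.norm_sub_le x y
  rw [dist_eq_norm, dist_eq_norm]
  refine h1.trans ?_
  push_cast
  rw [Real.coe_toNNReal _ hL, mul_assoc]
  gcongr
  linarith

theorem eventually_dist_leafField_le (hH : IsGLipschitzIntegrable H V 𝒰 U η) (hK : 0 < K)
    (hb : LiftBounds U η K) {a : Euc n} (ha : a ∈ U) : ∃ L, ∀ᶠ b in 𝓝 a, ∀ x,
      dist (leafField H η b x) (leafField H η a x) ≤ L * ‖b - a‖ := by
  obtain ⟨δ, hδ, L, hL, h⟩ := hH.exists_uniform ha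
  refine ⟨L * K, ?_⟩
  filter_upwards [hH.isOpen_U.mem_nhds ha, Metric.closedBall_mem_nhds a (div_pos hδ hK)]
    with b hbU hba x
  have h1 := (hb b hbU a ha x).2
  rw [mem_closedBall_iff_norm, le_div_iff₀ hK] at hba
  have h2 := (h x (liftLeaf η b x) (by linarith)).2 x (liftLeaf η a x)
    (by rw [sub_self, norm_zero]; exact hδ.le)
  rw [sub_self, norm_zero, zero_add] at h2
  rw [dist_eq_norm, mul_assoc]
  exact h2.trans (by gcongr)

/-- The second order expansion, in the momentum, of the energy of the leaves. -/
theorem eventually_energy_le (hH : IsGLipschitzIntegrable H V 𝒰 U η) (hK : 0 < K)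
    (hb : LiftBounds U η K) {a : Euc n} (ha : a ∈ U) : ∃ C, ∀ᶠ b in 𝓝 a, ∀ x,
      |liftHam H (0, liftLeaf η b 0) - liftHam H (0, liftLeaf η a 0) -
        inner ℝ (liftLeaf η b x - liftLeaf η a x) (leafField H η a x)| ≤ C * ‖b - a‖ ^ 2 := by
  obtain ⟨δ, hδ, L, hL, h⟩ := hH.exists_uniform ha
  refine ⟨L * K ^ 2, ?_⟩
  filter_upwards [hH.isOpen_U.mem_nhds ha, Metric.closedBall_mem_nhds a (div_pos hδ hK)]
    with b hbU hba x
  rw [← hH.liftHam_leaf_eq ha x, ← hH.liftHam_leaf_eq hbU x]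
  have h1 := (hb b hbU a ha x).2
  rw [mem_closedBall_iff_norm, le_div_iff₀ hK] at hba
  let r := ‖liftLeaf η b x - liftLeaf η a x‖
  have hd : ∀ p ∈ Metric.closedBall (liftLeaf η a x) r,
      HasFDerivAt (fun p => liftHam H (x, p) - inner ℝ (leafField H η a x) p)
        (innerSL ℝ ((hamVF H (x, p)).1 - leafField H η a x)) p ∧
      ‖(hamVF H (x, p)).1 - leafField H η a x‖ ≤ L * r := by
    intro p hp
    rw [mem_closedBall_iff_norm] at hp
    obtain ⟨hpV, hpL⟩ := h x p (hp.trans (by linarith))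
    constructor
    · have h2 := hasFDerivAt_liftHam_momentum hH.isOpen_V hH.isC2 hpV
      rw [map_sub]
      refine HasFDerivAt.sub (h2.congr_fderiv ?_) (innerSL ℝ (leafField H η a x)).hasFDerivAt
      ext v
      rw [ContinuousLinearMap.comp_apply, ContinuousLinearMap.inr_apply,
        fderiv_liftHam_apply hH.isOpen_V hH.isC2 hpV]
      simp
    · have h2 := hpL x (liftLeaf η a x) (by rw [sub_self, norm_zero]; exact hδ.le)
      rw [sub_self, norm_zero, zero_add] at h2
      exact h2.trans (by gcongr)
  have h2 := (convex_closedBall (liftLeaf η a x) r).norm_image_sub_le_of_norm_hasFDerivWithin_le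
    (fun p hp => (hd p hp).1.hasFDerivWithinAt) (C := L * r)
    (fun p hp => by rw [innerSL_apply_norm]; exact (hd p hp).2)
    (Metric.mem_closedBall_self (norm_nonneg _))
    (y := liftLeaf η b x) (by rw [mem_closedBall_iff_norm])
  have h3 : r ≤ K * ‖b - a‖ := h1
  rw [real_inner_comm, inner_sub_right]
  calc _ = ‖liftHam H (x, liftLeaf η b x) - inner ℝ (leafField H η a x) (liftLeaf η b x) -
        (liftHam H (x, liftLeaf η a x) - inner ℝ (leafField H η a x) (liftLeaf η a x))‖ := by
        rw [Real.norm_eq_abs]; congr 1; ring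
    _ ≤ L * r * r := h2
    _ ≤ L * (K * ‖b - a‖) * (K * ‖b - a‖) := by gcongr
    _ = L * K ^ 2 * ‖b - a‖ ^ 2 := by ring

theorem exists_isGradientFamily (hH : IsGLipschitzIntegrable H V 𝒰 U η) (hK : 0 < K)
    (hb : LiftBounds U η K) : ∃ S, IsGradientFamily U (liftLeaf η) S K := by
  have hex : ∀ a, ∃ S : Euc n → ℝ, a ∈ U → S 0 = 0 ∧
      ∀ x, HasFDerivAt S (innerSL ℝ (liftLeaf η a x)) x := by
    intro a
    by_cases ha : a ∈ U
    · obtain ⟨C, hC⟩ := hH.exists_lipschitzWith_liftLeaf ha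
      obtain ⟨S, hS⟩ := hC.exists_primitive (hH.lagrangian a ha).2
      exact ⟨S, fun _ => hS⟩
    · exact ⟨0, fun h => absurd h ha⟩
  choose S hS using hex
  exact ⟨S, hH.isOpen_U, hK, fun a ha => (hS a ha).1, fun a ha => (hS a ha).2,
    fun a _ x m hm => liftLeaf_add a x hm, fun a ha => hH.exists_lipschitzWith_liftLeaf ha,
    fun a ha b hb' x => (hb a ha b hb' x).1, fun a ha b hb' x => (hb a ha b hb' x).2⟩

end IsGLipschitzIntegrable

/-! ### Descent to the torus -/

theorem exists_lipschitzWith_torus {h : Euc n → Euc n} {M : ℝ≥0} (hL : LipschitzWith M h)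
    (hp : ∀ x, ∀ m ∈ intLattice n, h (x + m) = h x + m) :
    ∃ g : Torus n → Torus n, (∀ x, g (toTorus x) = toTorus (h x)) ∧ LipschitzWith M g := by
  let s := Function.surjInv (surjective_toTorus (n := n))
  have hg : ∀ x, toTorus (h (s (toTorus x))) = toTorus (h x) := by
    intro x
    obtain ⟨m, hm, hx⟩ := toTorus_eq.1 (Function.surjInv_eq surjective_toTorus (toTorus x))
    change s (toTorus x) = x + m at hx
    rw [hx, hp x m hm, toTorus_add_of_mem _ hm]
  refine ⟨fun q => toTorus (h (s q)), hg, LipschitzWith.of_dist_le_mul fun q q' => ?_⟩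
  refine le_of_forall_pos_le_add fun ε hε => ?_
  obtain ⟨x, x', rfl, rfl, hx⟩ := exists_norm_sub_lt_dist_add q q'
    (ε := ε / (M + 1)) (by positivity)
  rw [hg, hg]
  have hM : (M : ℝ) * (ε / (M + 1)) ≤ ε := by
    rw [mul_div_assoc', div_le_iff₀ (by positivity)]
    nlinarith
  calc _ ≤ ‖h x - h x'‖ := dist_toTorus_le _ _
    _ ≤ M * ‖x - x'‖ := hL.norm_sub_le _ _
    _ ≤ M * (dist (toTorus x) (toTorus x') + ε / (M + 1)) := by gcongr
    _ ≤ _ := by linarith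

theorem IsLipschitzSemiconj.exists_homeomorph_torus {F : ℝ → Euc n → Euc n} {h : Euc n → Euc n}
    {ω : Euc n} {M : ℝ≥0} (H : IsLipschitzSemiconj F h ω M)
    (hω : Dense {y | ∃ t : ℝ, ∃ m ∈ intLattice n, y = t • ω + m}) (hM : 1 ≤ M) :
    ∃ g : Torus n ≃ₜ Torus n, (∀ x, g (toTorus x) = toTorus (h x)) ∧
      LipschitzWith M g ∧ LipschitzWith M g.symm := by
  let e : Euc n ≃ Euc n := Equiv.ofBijective h ⟨H.injective hω hM, H.surjective hω⟩
  have he : ∀ x, h (e.symm x) = x := e.apply_symm_apply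
  have he' : ∀ x, e.symm (h x) = x := e.symm_apply_apply
  obtain ⟨g, hg, hgL⟩ := exists_lipschitzWith_torus H.lipschitz_semiconj H.semiconj_add
  obtain ⟨k, hk, hkL⟩ := exists_lipschitzWith_torus (h := e.symm) (M := M)
    (LipschitzWith.of_dist_le_mul fun x y => by
      have := H.norm_sub_le hω hM (e.symm x) (e.symm y)
      rwa [he, he, ← dist_eq_norm, ← dist_eq_norm] at this)
    (fun x m hm => by rw [← he' (e.symm x + m), H.semiconj_add _ m hm, he])
  refine ⟨⟨⟨g, k, fun q => ?_, fun q => ?_⟩, hgL.continuous, hkL.continuous⟩, hg, hgL, hkL⟩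
  · obtain ⟨x, rfl⟩ := surjective_toTorus q
    rw [hg, hk, he']
  · obtain ⟨x, rfl⟩ := surjective_toTorus q
    rw [hk, hg, he]

theorem torusRotation_zpow_apply (α : Euc n) (k : ℤ) (x : Euc n) :
    (torusRotation α ^ k) (toTorus x) = toTorus (x + (k : ℝ) • α) := by
  induction k generalizing x with
  | zero => simp
  | succ k ih =>
    have h : torusRotation α (toTorus x) = toTorus (x + α) := rfl
    rw [zpow_add_one, Homeomorph.mul_apply, h, ih]
    congr 1
    push_cast
    module
  | pred k ih =>
    have h : (torusRotation α)⁻¹ (toTorus x) = toTorus (x - α) := by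
      change (torusRotation α).symm _ = _
      rw [Homeomorph.symm_apply_eq]
      exact (sub_add_cancel (toTorus x) (toTorus α)).symm
    rw [zpow_sub_one, Homeomorph.mul_apply, h, ih]
    congr 1
    push_cast
    module

theorem IsMinimalHomeo.dense_setOf_smul_add {α : Euc n} (hα : IsMinimalHomeo (torusRotation α)) :
    Dense {y | ∃ t : ℝ, ∃ m ∈ intLattice n, y = t • α + m} := by
  refine ((hα (toTorus 0)).preimage
    (QuotientAddGroup.isOpenMap_coe (N := intLattice n))).mono ?_
  rintro y ⟨k, hk⟩
  obtain ⟨m, hm, hy⟩ := toTorus_eq.1 (hk.symm.trans (torusRotation_zpow_apply α k 0))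
  exact ⟨k, m, hm, by rw [hy, zero_add]⟩

/-! ### Rotation vectors and conjugacies of the leaf flows -/

variable {K : ℝ} {F : Euc n → ℝ → Euc n → Euc n}

namespace IsGLipschitzIntegrable

theorem tendsto_leafFlow (hH : IsGLipschitzIntegrable H V 𝒰 U η) (hK : 0 < K)
    (hb : LiftBounds U η K) (hF : ∀ a ∈ U, IsFlowOf (leafField H η a) (F a)) {a : Euc n}
    (ha : a ∈ U) (t : ℝ) (x : Euc n) : Tendsto (fun b => F b t x) (𝓝 a) (𝓝 (F a t x)) := by
  obtain ⟨C, hC⟩ := hH.exists_lipschitzWith_leafField ha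
  obtain ⟨L, hL⟩ := hH.eventually_dist_leafField_le hK hb ha
  refine (hF a ha).tendsto hC (Y := leafField H η) (ε := fun b => L * ‖b - a‖) ?_ ?_ hL t x
  · filter_upwards [hH.isOpen_U.mem_nhds ha] with b hb using hF b hb
  · have : Continuous fun b => L * ‖b - a‖ := by fun_prop
    simpa using this.tendsto a

/-- Each leaf flow is semiconjugate to a translation flow: on the dense set of regular leaves by
the derivative of the generating function in the parameter, on the others by passing to the limit,
as the Lipschitz constants are uniform. -/
theorem exists_isLipschitzSemiconj_leafFlow (hH : IsGLipschitzIntegrable H V 𝒰 U η) (hK : 0 < K)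
    (hb : LiftBounds U η K) (hF : ∀ a ∈ U, IsFlowOf (leafField H η a) (F a)) {M : ℝ≥0}
    (hM : K ^ 2 ≤ M) {a : Euc n} (ha : a ∈ U) : ∃ h ω, IsLipschitzSemiconj (F a) h ω M := by
  obtain ⟨S, hS⟩ := hH.exists_isGradientFamily hK hb
  have hadd : ∀ b ∈ U, ∀ s t x, F b (s + t) x = F b s (F b t x) := fun b hb' => by
    obtain ⟨C, hC⟩ := hH.exists_lipschitzWith_leafField hb'
    exact (hF b hb').add hC
  have hper : ∀ b ∈ U, ∀ t x, ∀ m ∈ intLattice n, F b t (x + m) = F b t x + m :=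
    fun b hb' t x m hm => by
      obtain ⟨C, hC⟩ := hH.exists_lipschitzWith_leafField hb'
      exact (hF b hb').map_add hC (fun x => leafField_add b x hm) t x
  have hreg : ∀ k : ℕ, ∃ b ∈ U, ‖b - a‖ < 1 / (k + 1 : ℝ) ∧
      IsGradientFamily.IsRegular (liftLeaf η) S b :=
    fun k => hS.exists_isRegular ha Nat.one_div_pos_of_nat
  choose b hbU hba hbr using hreg
  have hlim : Tendsto b atTop (𝓝 a) := by
    rw [tendsto_iff_norm_sub_tendsto_zero]
    exact squeeze_zero (fun _ => norm_nonneg _) (fun k => (hba k).le)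
      tendsto_one_div_add_atTop_nhds_zero_nat
  refine IsLipschitzSemiconj.exists_of_tendsto (Fk := fun k => F (b k)) (fun k => ?_)
    (fun t x => (hH.tendsto_leafFlow hK hb hF ha t x).comp hlim) (hF a ha).zero (hadd a ha)
    (hper a ha)
  obtain ⟨C, hC⟩ := hH.exists_lipschitzWith_leafField (hbU k)
  obtain ⟨D, hD⟩ := hH.eventually_energy_le hK hb (hbU k)
  exact hS.exists_isLipschitzSemiconj (hbU k) (hbr k) (hF _ (hbU k)).zero (hadd _ (hbU k))
    (hper _ (hbU k)) ((hF _ (hbU k)).exists_lipschitzWith hC) (hF _ (hbU k)).hasDerivAt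
    (e := fun b => liftHam H (0, liftLeaf η b 0)) hD hM

end IsGLipschitzIntegrable

/-- The rotation vector is reached at the speed `1 / t`, uniformly for semiconjugacies with a
uniform Lipschitz constant. -/
theorem tendstoUniformlyOn_of_isLipschitzSemiconj {h : Euc n → Euc n → Euc n} {ρ : Euc n → Euc n}
    {M : ℝ≥0} (hs : ∀ a ∈ U, IsLipschitzSemiconj (F a) (h a) (ρ a) M) :
    TendstoUniformlyOn (fun (t : ℝ) (z : Euc n × Euc n) => (1 / t) • (F z.1 t z.2 - z.2))
      (fun z => ρ z.1) atTop (U ×ˢ univ) := by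
  rw [Metric.tendstoUniformlyOn_iff]
  intro ε hε
  have h0 : Tendsto (fun t : ℝ => 2 * ((M + 1) * √n) / t) atTop (𝓝 0) :=
    tendsto_const_nhds.div_atTop tendsto_id
  filter_upwards [h0.eventually_lt_const hε, eventually_gt_atTop 0] with t ht ht0 z hz
  have h1 := (hs z.1 hz.1).norm_sub_smul_le t z.2
  have h2 : (1 / t) • (F z.1 t z.2 - z.2) - ρ z.1 = (1 / t) • (F z.1 t z.2 - z.2 - t • ρ z.1) := by
    rw [smul_sub _ _ (t • ρ z.1), smul_smul, one_div_mul_cancel ht0.ne', one_smul]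
  rw [dist_comm, dist_eq_norm, h2, norm_smul, Real.norm_of_nonneg (by positivity),
    one_div_mul_eq_div]
  exact (div_le_div_of_nonneg_right h1 ht0.le).trans_lt ht

/-- The constant `K ^ 2` of the estimates on the cover is at most `K ^ max n 2`: either the torus
is a point, or two parameters show that `1 ≤ K`. -/
theorem LipschitzWith.torus_dist_le_pow {g : Torus n → Torus n} {M : ℝ≥0}
    (hg : LipschitzWith M g) (hU : IsOpen U) (hne : U.Nonempty) (hK : 0 < K)
    (hb : IsGLipschitzIntegrable.LiftBounds U η K) (hM : (M : ℝ) = max 1 (K ^ 2)) (q q' : Torus n) :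
    dist (g q) (g q') ≤ K ^ max n 2 * dist q q' := by
  rcases subsingleton_or_nontrivial (Euc n) with hn | hn
  · have := surjective_toTorus (n := n) |>.subsingleton
    rw [Subsingleton.elim q q', dist_self, dist_self, mul_zero]
  obtain ⟨a, ha⟩ := hne
  have := Module.punctured_nhds_neBot ℝ (Euc n) a
  obtain ⟨b, hbU, hab⟩ := Filter.nonempty_of_mem
    (inter_mem (mem_nhdsWithin_of_mem_nhds (hU.mem_nhds ha)) (self_mem_nhdsWithin (s := {a}ᶜ)))
  obtain ⟨h1, h2⟩ := hb a ha b hbU 0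
  have hpos : 0 < ‖a - b‖ := norm_pos_iff.2 (sub_ne_zero.2 (Ne.symm hab))
  have hK2 : 1 ≤ K ^ 2 := by
    refine le_of_mul_le_mul_right ?_ hpos
    calc _ ≤ K * (K * ‖a - b‖) := by rw [one_mul]; exact h1.trans (by gcongr)
      _ = K ^ 2 * ‖a - b‖ := by ring
  have hK1 : 1 ≤ K := (one_le_sq_iff₀ hK.le).1 hK2
  refine (hg.dist_le_mul q q').trans ?_
  rw [hM, max_eq_right hK2]
  refine mul_le_mul_of_nonneg_right ?_ dist_nonneg
  exact pow_le_pow_right₀ hK1 (le_max_right _ _)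

theorem mainTheorem5 (n : ℕ) (H : CotTorus n → ℝ) (V 𝒰 : Set (CotTorus n))
    (U : Set (Euc n)) (η : Euc n → Torus n → Euc n)
    (hH : IsGLipschitzIntegrable H V 𝒰 U η)
    (K : ℝ) (hK : 0 < K)
    (hKη : ∀ q : Torus n, ∀ a ∈ U, ∀ a' ∈ U,
      1 / K * ‖a - a'‖ ≤ ‖η a q - η a' q‖ ∧ ‖η a q - η a' q‖ ≤ K * ‖a - a'‖) :
    (∀ a ∈ U, ∀ t : ℝ, ∀ q : Torus n,
      hamFlow H V t (q, η a q) =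
        (leafFlow H V (η a) t q, η a (leafFlow H V (η a) t q))) ∧
    ∃ (F : Euc n → ℝ → Euc n → Euc n) (ρ : Euc n → Euc n),
      (∀ a ∈ U, IsFlowLift (leafFlow H V (η a)) (F a)) ∧
      TendstoUniformlyOn (fun (t : ℝ) (z : Euc n × Euc n) => (1 / t) • (F z.1 t z.2 - z.2))
        (fun z => ρ z.1) atTop (U ×ˢ univ) ∧
      ContinuousOn ρ U ∧
      ∀ a ∈ U, IsMinimalHomeo (torusRotation (ρ a)) →
        ∃ h : Torus n ≃ₜ Torus n,
          (∀ t : ℝ, ⇑h ∘ leafFlow H V (η a) t = ⇑(torusRotation (t • ρ a)) ∘ ⇑h) ∧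
          ∀ q q' : Torus n,
            dist (h q) (h q') ≤ K ^ max n 2 * dist q q' ∧
            dist q q' ≤ K ^ max n 2 * dist (h q) (h q') := by
  have hb : IsGLipschitzIntegrable.LiftBounds U η K := fun a ha b hb x => by
    obtain ⟨h1, h2⟩ := hKη (toTorus x) a ha b hb
    rw [one_div_mul_eq_div, div_le_iff₀' hK] at h1
    exact ⟨h1, h2⟩
  have hex : ∀ a, ∃ F : ℝ → Euc n → Euc n, a ∈ U → IsFlowOf (leafField H η a) F ∧
      ∀ t x, hamFlow H V t (toTorus x, η a (toTorus x)) =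
        (toTorus (F t x), η a (toTorus (F t x))) := fun a => by
    by_cases ha : a ∈ U
    · obtain ⟨F, hF, -, hF'⟩ := hH.exists_leafFlow ha
      exact ⟨F, fun _ => ⟨hF, hF'⟩⟩
    · exact ⟨fun _ x => x, fun h => absurd h ha⟩
  choose F hF using hex
  have hflow : ∀ a ∈ U, IsFlowOf (leafField H η a) (F a) := fun a ha => (hF a ha).1
  have hproj : ∀ a ∈ U, ∀ t x, toTorus (F a t x) = leafFlow H V (η a) t (toTorus x) :=
    fun a ha t x => by rw [leafFlow, (hF a ha).2]
  have hM : K ^ 2 ≤ (Real.toNNReal (max 1 (K ^ 2)) : ℝ) :=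
    (le_max_right _ _).trans (Real.le_coe_toNNReal _)
  have hex : ∀ a, ∃ h ω, a ∈ U → IsLipschitzSemiconj (F a) h ω (Real.toNNReal (max 1 (K ^ 2))) :=
    fun a => by
      by_cases ha : a ∈ U
      · obtain ⟨h, ω, hs⟩ := hH.exists_isLipschitzSemiconj_leafFlow hK hb hflow hM ha
        exact ⟨h, ω, fun _ => hs⟩
      · exact ⟨id, 0, fun h => absurd h ha⟩
  choose h ρ hs using hex
  have hunif := tendstoUniformlyOn_of_isLipschitzSemiconj (F := F) hs
  refine ⟨fun a ha t q => ?_, F, ρ, fun a ha => ⟨(hflow a ha).zero, ?_, hproj a ha⟩, hunif, ?_,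
    fun a ha hmin => ?_⟩
  · obtain ⟨x, rfl⟩ := surjective_toTorus q
    rw [← hproj a ha, (hF a ha).2]
  · obtain ⟨C, hC⟩ := hH.exists_lipschitzWith_leafField ha
    exact (hflow a ha).continuous hC
  · have h1 : TendstoUniformlyOn (fun (t : ℝ) a => (1 / t) • (F a t 0 - 0)) ρ atTop U := by
      refine (hunif.comp fun a : Euc n => (a, (0 : Euc n))).mono fun a ha => ?_
      exact ⟨ha, mem_univ _⟩
    refine h1.continuousOn (Frequently.of_forall fun t a ha => ?_)
    exact (((hH.tendsto_leafFlow hK hb hflow ha t 0).sub_const 0).const_smul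
      (1 / t)).mono_left nhdsWithin_le_nhds
  · obtain ⟨g, hg, hgL, hgL'⟩ := (hs a ha).exists_homeomorph_torus hmin.dense_setOf_smul_add
      (Real.one_le_toNNReal.2 (le_max_left _ _))
    have hM' : (Real.toNNReal (max 1 (K ^ 2)) : ℝ) = max 1 (K ^ 2) :=
      Real.coe_toNNReal _ (by positivity)
    refine ⟨g, fun t => funext fun q => ?_, fun q q' => ⟨?_, ?_⟩⟩
    · obtain ⟨x, rfl⟩ := surjective_toTorus q
      rw [Function.comp_apply, Function.comp_apply, ← hproj a ha, hg, hg, (hs a ha).semiconj]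
      rfl
    · exact hgL.torus_dist_le_pow hH.isOpen_U ⟨a, ha⟩ hK hb hM' q q'
    · simpa using hgL'.torus_dist_le_pow hH.isOpen_U ⟨a, ha⟩ hK hb hM' (g q) (g q')
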